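/- Let $l\in\{0,1,2,\dots\}$, $\varepsilon>0$, $r_0>0$ and $\Lambda\le 0$. Let $W$ be the principal branch of the Lambert function, so that $W(1)e^{W(1)}=1$, and assume that $\varepsilon^{-2}W(1)^2-l(l+1)-\tfrac14>0$. Put $$\beta=\sqrt{-l(l+1)+\varepsilon^{-2}W(1)^2-\tfrac14},\qquad \phi_\beta=\arg\Gamma(1+i\beta),\qquad \xi_0=\sqrt{\varepsilon^{-2}\Lambda}\;r_0\in i[0,\infty),$$ $$V(r)=\begin{cases}\Lambda, & 0\le r\le r_0,\\ -W(1)^2/r^2, & r>r_0,\end{cases}\qquad f(\xi)=\frac{I_{l+1/2}(\xi)}{2\xi\, I_{l+1/2}'(\xi)},$$ where $I_\nu$ is the modified Bessel function of the first kind (principal branch). A real number $E$ is called an eigenvalue if there is a function $u:(0,\infty)\to\mathbb R$, differentiable with locally absolutely continuous derivative, such that $$-\varepsilon^2\Big(u''(r)-\frac{l(l+1)}{r^2}u(r)\Big)+V(r)u(r)=E\,u(r)\quad\text{for a.e. } r>0,$$ $$u\in L^2(0,\infty),\qquad \lim_{r\to0^+}u(r)=0,\qquad \lim_{r\to0^+}r^{-(l+1)}u(r)=1.$$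 Then $\lim_{\xi\to0,\ \xi\in\mathbb C\setminus(-\infty,0]}f(\xi)=\frac1{2l+1}$, and for $\Lambda=0$ one sets $f(\xi_0)=f(0):=\frac1{2l+1}$. If $\Lambda<0$ and $I_{l+1/2}'(\xi_0)\neq0$, then $f(\xi_0)$ is real. Moreover, there are a sequence $(E_n)_{n\ge0}$ of negative eigenvalues with $E_n\to0$ (in particular, there are infinitely many negative eigenvalues) and a real sequence $\zeta_n\to0$ such that, for all $n$, $$E_n=-\varepsilon^2\,\frac{4}{r_0^2}\,\exp\!\Big(\frac2\beta\big(\arctan(2\beta f(\xi_0))+\phi_\beta-n\pi\big)\Big)\,(1+\zeta_n).$$ If $\Lambda<0$ and $I_{l+1/2}'(\xi_0)=0$, so that $\xi_0$ is a pole of $f$, the formula holds with $\arctan(2\beta f(\xi_0))$ read as $\frac\pi2$. -/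

import Mathlib

open Filter Topology MeasureTheory

/-- The principal branch `W` of the Lambert function: the inverse of `w ↦ w * exp w` on
`[-1, ∞)`. -/
noncomputable def lambertW (x : ℝ) : ℝ :=
  Function.invFunOn (fun w : ℝ => w * Real.exp w) (Set.Ici (-1)) x

/-- On its natural domain, `lambertW` solves the defining equation and takes values in
`[-1, ∞)`. -/
theorem lambertW_spec {x : ℝ} (hx : -Real.exp (-1) ≤ x) :
    -1 ≤ lambertW x ∧ lambertW x * Real.exp (lambertW x) = x := by
  have hc : ContinuousOn (fun w : ℝ => w * Real.exp w) (Set.Icc (-1) (max x 0)) := by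
    fun_prop
  have hle : (-1 : ℝ) ≤ max x 0 := le_trans (by norm_num) (le_max_right x 0)
  have htop : x ≤ max x 0 * Real.exp (max x 0) := by
    have h0 : 0 ≤ max x 0 := le_max_right x 0
    have h1 : 1 ≤ Real.exp (max x 0) := Real.one_le_exp h0
    have h2 : x ≤ max x 0 := le_max_left x 0
    nlinarith
  have hmem : x ∈ Set.Icc ((-1 : ℝ) * Real.exp (-1)) (max x 0 * Real.exp (max x 0)) :=
    ⟨by linarith, htop⟩
  obtain ⟨w, hw, hwx⟩ := intermediate_value_Icc hle hc hmem
  have hex : ∃ a ∈ Set.Ici (-1 : ℝ), (fun w : ℝ => w * Real.exp w) a = x := ⟨w, hw.1, hwx⟩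
  exact ⟨Function.invFunOn_mem hex, Function.invFunOn_eq hex⟩

/-- The modified Bessel function of the first kind (principal branch),
`I_ν(z) = (z/2)^ν * ∑ (z/2)^(2k) / (k! Γ(ν + k + 1))`. -/
noncomputable def besselI (ν z : ℂ) : ℂ :=
  (z / 2) ^ ν *
    ∑' k : ℕ, (z / 2) ^ (2 * k) / ((k.factorial : ℂ) * Complex.Gamma (ν + (k : ℂ) + 1))

/-- `I_{l+1/2}`. -/
noncomputable def besselIHalf (l : ℕ) (z : ℂ) : ℂ := besselI ((l : ℂ) + 1 / 2) z

/-- `f(ξ) = I_{l+1/2}(ξ) / (2 ξ I'_{l+1/2}(ξ))`. -/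
noncomputable def efimovF (l : ℕ) (ξ : ℂ) : ℂ :=
  besselIHalf l ξ / (2 * ξ * deriv (besselIHalf l) ξ)

/-- The potential equal to `Λ` on `[0, r₀]` and to `-W(1)² / r²` for `r > r₀`. -/
noncomputable def auxPotential (Λ r₀ : ℝ) (r : ℝ) : ℝ :=
  if r ≤ r₀ then Λ else -(lambertW 1) ^ 2 / r ^ 2

/-- `u` solves the radial problem with angular momentum `l`, potential `V` and energy `E`:
`-ε² (u'' - l(l+1)/r² u) + V u = E u` on `(0, ∞)`, with `u ∈ L²(0, ∞)`, `u(r) → 0` and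
`r^{-(l+1)} u(r) → 1` as `r → 0⁺`. Solutions are taken in the usual Sturm-Liouville sense:
`u` is differentiable, `u'` is locally absolutely continuous, and the equation holds almost
everywhere. -/
structure IsRadialSolution (ε : ℝ) (l : ℕ) (V : ℝ → ℝ) (E : ℝ) (u : ℝ → ℝ) : Prop where
  differentiableOn : DifferentiableOn ℝ u (Set.Ioi 0)
  deriv_absolutelyContinuous :
    ∀ a b : ℝ, 0 < a → a ≤ b → AbsolutelyContinuousOnInterval (deriv u) a b
  equation : ∀ᵐ r ∂(volume.restrict (Set.Ioi (0 : ℝ))),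
    -ε ^ 2 * (deriv (deriv u) r - (l : ℝ) * ((l : ℝ) + 1) / r ^ 2 * u r) + V r * u r = E * u r
  memLp : MemLp u 2 (volume.restrict (Set.Ioi (0 : ℝ)))
  tendsto_zero : Tendsto u (𝓝[>] 0) (𝓝 0)
  normalized : Tendsto (fun r => u r / r ^ (l + 1)) (𝓝[>] 0) (𝓝 1)

/-- `E` is an eigenvalue of the radial problem. (The normalization forces the eigenfunction
to be nonzero.) -/
def IsRadialEigenvalue (ε : ℝ) (l : ℕ) (V : ℝ → ℝ) (E : ℝ) : Prop :=
  ∃ u : ℝ → ℝ, IsRadialSolution ε l V E u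

/-- `β = √(-l(l+1) + ε⁻² W(1)² - 1/4)`. -/
noncomputable def efimovBeta (ε : ℝ) (l : ℕ) : ℝ :=
  Real.sqrt (-((l : ℝ) * ((l : ℝ) + 1)) + lambertW 1 ^ 2 / ε ^ 2 - 1 / 4)

/-- `φ_β = arg Γ(1 + iβ)`. -/
noncomputable def efimovPhi (β : ℝ) : ℝ :=
  Complex.arg (Complex.Gamma (1 + Complex.I * (β : ℂ)))

/-- `ξ₀ = √(ε⁻² Λ) r₀`, which lies on the nonnegative imaginary axis for `Λ ≤ 0`. -/
noncomputable def efimovXi (ε Λ r₀ : ℝ) : ℂ :=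
  Complex.sqrt ((Λ / ε ^ 2 : ℝ) : ℂ) * (r₀ : ℂ)

/-! Write E = -ε²κ² and x = κ r₀. Inside the well the solution regular at 0 is r^{l+1} G(q r²) with
q = Λ/ε² + κ², where G(w) = 2^ν w^{-ν/2} I_ν(√w), ν = l + 1/2, is entire; this avoids branches of
the square root. Outside, the term l(l+1)/r² and the potential combine into -(β² + 1/4)/r², and the
solution decaying at infinity is √r K_{iβ}(κr), up to a factor. E is an eigenvalue as soon as the
two pieces match to first order at r₀.

Put H(x) = x K_{1+iβ}(x). Then Im H = β K_{iβ} and Re H = -x K'_{iβ}, so one complex function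
carries the Cauchy data of the outer solution. With w = Λ r₀²/ε² + x² and b(w) = νG(w) + 2wG'(w),
matching says that (b(w) + iβ G(w)) H(x) is real.

As x → 0⁺, H(x) = e^{-iβ log(x/2)} A(x²/4) with A → Γ(1+iβ), of argument φ_β, while the first factor
tends to ρ e^{iα}, ρ real. Here tan α = βG/b = 2β f(ξ₀), with α = π/2 when b = 0. The phase α + φ_β
- β log(x/2) + o(1) grows without bound and, by continuity, meets every large multiple nπ. Solving
for x gives E_n = -ε² x_n²/r₀², the claimed asymptotics.

The main ingredients are the absence of common zeros of G and b (`besselEntire_no_common_zero`,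
needed for ρ ≠ 0), the first-order system for H (`hasDerivAt_macdonaldH`), the intermediate value
argument (`exists_phase_sequence`) and the gluing (`isRadialEigenvalue_of_match`). -/

/-! ### Power series with exponentially bounded coefficients -/

/-- The power series `∑ cₖ wᵏ` with real coefficients, over `ℝ` or `ℂ`. -/
noncomputable def scalarSeries (𝕜 : Type*) [RCLike 𝕜] (c : ℕ → ℝ) (w : 𝕜) : 𝕜 :=
  ∑' k : ℕ, (c k : 𝕜) * w ^ k

/-- Coefficients of the formal derivative. -/
def derivCoeff (c : ℕ → ℝ) (k : ℕ) : ℝ := ((k : ℝ) + 1) * c (k + 1)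

/-- Coefficients bounded by those of a multiple of the exponential series. -/
def ExpBounded (c : ℕ → ℝ) : Prop := ∃ C : ℝ, ∀ k, |c k| ≤ C / (k.factorial : ℝ)

theorem ExpBounded.deriv {c : ℕ → ℝ} (h : ExpBounded c) : ExpBounded (derivCoeff c) := by
  obtain ⟨C, hC⟩ := h
  refine ⟨C, fun k => ?_⟩
  have h1 := hC (k + 1)
  have hk : (0 : ℝ) < k.factorial := by positivity
  rw [Nat.factorial_succ, le_div_iff₀ (by positivity)] at h1
  rw [derivCoeff, abs_mul, abs_of_nonneg (by positivity : (0 : ℝ) ≤ (k : ℝ) + 1),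
    le_div_iff₀ hk]
  push_cast at h1
  linarith

section series

variable {𝕜 : Type*} [RCLike 𝕜] {c : ℕ → ℝ}

theorem ExpBounded.summable_norm (h : ExpBounded c) (R : ℝ) :
    Summable fun k : ℕ => |c k| * |R| ^ k := by
  obtain ⟨C, hC⟩ := h
  refine Summable.of_nonneg_of_le (fun k => by positivity) (fun k => ?_)
    ((Real.summable_pow_div_factorial |R|).mul_left C)
  calc |c k| * |R| ^ k ≤ C / (k.factorial : ℝ) * |R| ^ k := by gcongr; exact hC k
    _ = _ := by ring

theorem ExpBounded.summable (h : ExpBounded c) (w : 𝕜) :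
    Summable fun k : ℕ => (c k : 𝕜) * w ^ k := by
  refine Summable.of_norm_bounded (h.summable_norm ‖w‖) fun k => ?_
  rw [norm_mul, norm_pow, RCLike.norm_ofReal, abs_norm]

/-- Termwise differentiation on a ball slightly larger than ‖w‖, where the differentiated series is
dominated uniformly. -/
theorem ExpBounded.hasDerivAt (h : ExpBounded c) (w : 𝕜) :
    HasDerivAt (scalarSeries 𝕜 c) (scalarSeries 𝕜 (derivCoeff c) w) w := by
  set R : ℝ := ‖w‖ + 1
  have hR : 0 < R := by positivity
  have hsum : Summable fun k : ℕ => |c k| * (k * R ^ (k - 1)) := by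
    rw [← summable_nat_add_iff 1]
    refine (h.deriv.summable_norm R).congr fun k => ?_
    rw [derivCoeff, abs_mul, abs_of_pos hR, abs_of_nonneg (by positivity : (0 : ℝ) ≤ (k : ℝ) + 1)]
    push_cast
    ring
  have key := hasDerivAt_tsum_of_isPreconnected (𝕜 := 𝕜) (t := Metric.ball (0 : 𝕜) R)
    (g := fun k w => (c k : 𝕜) * w ^ k) (g' := fun k w => (c k : 𝕜) * (k * w ^ (k - 1)))
    (y₀ := w) (y := w) hsum Metric.isOpen_ball
    (convex_ball (0 : 𝕜) R).isPreconnected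
    (fun k y _ => (hasDerivAt_pow k y).const_mul _)
    (fun k y hy => by
      have hy' : ‖y‖ ≤ R := (mem_ball_zero_iff.1 hy).le
      rw [norm_mul, norm_mul, norm_pow, RCLike.norm_ofReal, RCLike.norm_natCast]
      gcongr)
    (by simp [R]) (h.summable w) (by simp [R])
  convert! key using 1
  have hs : Summable fun k : ℕ => (c k : 𝕜) * ((k : 𝕜) * w ^ (k - 1)) := by
    refine Summable.of_norm_bounded hsum fun k => ?_
    rw [norm_mul, norm_mul, norm_pow, RCLike.norm_ofReal, RCLike.norm_natCast]
    gcongr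
    simp [R]
  rw [scalarSeries, hs.tsum_eq_zero_add]
  simp only [Nat.cast_zero, zero_mul, mul_zero, zero_add, derivCoeff, Nat.add_sub_cancel]
  refine tsum_congr fun k => ?_
  push_cast
  ring

theorem scalarSeries_ofReal (x : ℝ) :
    scalarSeries ℂ c (x : ℂ) = ((scalarSeries ℝ c x : ℝ) : ℂ) := by
  simp [scalarSeries, Complex.ofReal_tsum]

theorem scalarSeries_zero : scalarSeries 𝕜 c 0 = (c 0 : 𝕜) := by
  rw [scalarSeries, tsum_eq_single 0]
  · simp
  · intro k hk
    simp [hk]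

end series

/-! ### The entire function behind I_{l+1/2} -/

/-- Coefficients of `w ↦ w^{-ν/2} 2^ν I_ν(√w)` for `ν = l + 1/2`. -/
noncomputable def besselCoeff (l k : ℕ) : ℝ :=
  1 / (4 ^ k * (k.factorial : ℝ) * Real.Gamma ((l : ℝ) + 1 / 2 + k + 1))

theorem besselCoeff_pos (l k : ℕ) : 0 < besselCoeff l k := by
  have : 0 < Real.Gamma ((l : ℝ) + 1 / 2 + k + 1) := Real.Gamma_pos_of_pos (by positivity)
  unfold besselCoeff
  positivity

/-- The functional equation of Γ. This recurrence yields both the growth bound and the differential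
equation. -/
theorem besselCoeff_succ (l k : ℕ) :
    4 * ((k : ℝ) + 1) * ((l : ℝ) + 1 / 2 + k + 1) * besselCoeff l (k + 1) = besselCoeff l k := by
  have h0 : (0 : ℝ) < (l : ℝ) + 1 / 2 + k + 1 := by positivity
  have hG : 0 < Real.Gamma ((l : ℝ) + 1 / 2 + k + 1) := Real.Gamma_pos_of_pos h0
  have h1 : Real.Gamma ((l : ℝ) + 1 / 2 + (k + 1 : ℕ) + 1)
      = ((l : ℝ) + 1 / 2 + k + 1) * Real.Gamma ((l : ℝ) + 1 / 2 + k + 1) := by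
    rw [← Real.Gamma_add_one h0.ne']
    push_cast
    ring_nf
  unfold besselCoeff
  rw [h1, Nat.factorial_succ, pow_succ]
  push_cast
  field_simp

theorem besselCoeff_expBounded (l : ℕ) : ExpBounded (besselCoeff l) := by
  refine ⟨besselCoeff l 0, fun k => ?_⟩
  rw [abs_of_pos (besselCoeff_pos l k)]
  induction k with
  | zero => simp
  | succ k ih =>
    have h := besselCoeff_succ l k
    have hp := besselCoeff_pos l (k + 1)
    have hk : (0 : ℝ) < k.factorial := by positivity
    rw [← h, le_div_iff₀ hk] at ih
    rw [Nat.factorial_succ, le_div_iff₀ (by positivity)]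
    push_cast
    refine le_trans ?_ ih
    have : (1 : ℝ) ≤ 4 * ((l : ℝ) + 1 / 2 + k + 1) := by
      have : (0 : ℝ) ≤ (l : ℝ) + k := by positivity
      linarith
    calc besselCoeff l (k + 1) * (((k : ℝ) + 1) * k.factorial)
        ≤ besselCoeff l (k + 1) * (((k : ℝ) + 1) * k.factorial) *
          (4 * ((l : ℝ) + 1 / 2 + k + 1)) := le_mul_of_one_le_right (by positivity) this
      _ = _ := by ring

/-- `w ↦ w^{-ν/2} 2^ν I_ν(√w)` for `ν = l + 1/2`, an entire function. -/
noncomputable abbrev besselEntire (𝕜 : Type*) [RCLike 𝕜] (l : ℕ) : 𝕜 → 𝕜 :=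
  scalarSeries 𝕜 (besselCoeff l)

/-- The derivative of `besselEntire`. -/
noncomputable abbrev besselEntireDeriv (𝕜 : Type*) [RCLike 𝕜] (l : ℕ) : 𝕜 → 𝕜 :=
  scalarSeries 𝕜 (derivCoeff (besselCoeff l))

/-- The second derivative of `besselEntire`. -/
noncomputable abbrev besselEntireDeriv₂ (𝕜 : Type*) [RCLike 𝕜] (l : ℕ) : 𝕜 → 𝕜 :=
  scalarSeries 𝕜 (derivCoeff (derivCoeff (besselCoeff l)))

section entire

variable {𝕜 : Type*} [RCLike 𝕜] (l : ℕ)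

theorem hasDerivAt_besselEntire (w : 𝕜) :
    HasDerivAt (besselEntire 𝕜 l) (besselEntireDeriv 𝕜 l w) w :=
  (besselCoeff_expBounded l).hasDerivAt w

theorem hasDerivAt_besselEntireDeriv (w : 𝕜) :
    HasDerivAt (besselEntireDeriv 𝕜 l) (besselEntireDeriv₂ 𝕜 l w) w :=
  (besselCoeff_expBounded l).deriv.hasDerivAt w

theorem continuous_besselEntire : Continuous (besselEntire 𝕜 l) :=
  continuous_iff_continuousAt.2 fun w => (hasDerivAt_besselEntire l w).continuousAt

theorem continuous_besselEntireDeriv : Continuous (besselEntireDeriv 𝕜 l) :=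
  continuous_iff_continuousAt.2 fun w => (hasDerivAt_besselEntireDeriv l w).continuousAt

theorem besselEntire_zero_pos : 0 < besselEntire ℝ l 0 := by
  rw [besselEntire, scalarSeries_zero]
  exact besselCoeff_pos l 0

theorem besselEntire_ode (w : ℝ) :
    w * besselEntireDeriv₂ ℝ l w + ((l : ℝ) + 3 / 2) * besselEntireDeriv ℝ l w
      = besselEntire ℝ l w / 4 := by
  have hb := besselCoeff_expBounded l
  have hs : Summable fun k : ℕ => (k : ℝ) * derivCoeff (besselCoeff l) k * w ^ k := by
    rw [← summable_nat_add_iff 1]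
    refine ((hb.deriv.deriv.summable w).mul_left w).congr fun k => ?_
    simp only [derivCoeff, RCLike.ofReal_real_eq_id, id]
    push_cast
    ring
  have h2 : w * besselEntireDeriv₂ ℝ l w
      = ∑' k : ℕ, (k : ℝ) * derivCoeff (besselCoeff l) k * w ^ k := by
    rw [hs.tsum_eq_zero_add, besselEntireDeriv₂, scalarSeries, ← tsum_mul_left]
    simp only [Nat.cast_zero, zero_mul, zero_add]
    refine tsum_congr fun k => ?_
    simp only [derivCoeff, RCLike.ofReal_real_eq_id, id]
    push_cast
    ring
  rw [h2, besselEntireDeriv, scalarSeries, besselEntire, scalarSeries, ← tsum_mul_left,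
    ← hs.tsum_add ((hb.deriv.summable w).mul_left _), ← tsum_div_const]
  refine tsum_congr fun k => ?_
  simp only [derivCoeff, RCLike.ofReal_real_eq_id, id]
  rw [← besselCoeff_succ l k]
  ring

/-- `besselEntire` and its derivative have no common zero on the nonpositive half-line. -/
theorem besselEntire_no_common_zero {w₀ : ℝ} (hw₀ : w₀ ≤ 0) (h0 : besselEntire ℝ l w₀ = 0)
    (h1 : w₀ * besselEntireDeriv ℝ l w₀ = 0) : False := by
  set G := besselEntire ℝ l with hG
  set G₁ := besselEntireDeriv ℝ l
  set G₂ := besselEntireDeriv₂ ℝ l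
  have hpos : 0 < G 0 := besselEntire_zero_pos l
  -- An energy function. The exponent 2l + 2 makes the `G₁ ^ 2` terms cancel in the derivative,
  -- which then has a sign for w ≤ 0. A common zero gives Φ(w₀) = 0, hence Φ ≤ 0 on [w₀, 0],
  -- although Φ > 0 just left of 0.
  let Φ : ℝ → ℝ := fun w => (-w) ^ (2 * l + 2) * (G w ^ 2 / 4 - w * G₁ w ^ 2)
  have hd : ∀ w, HasDerivAt Φ (-(2 * (l : ℝ) + 2) * (-w) ^ (2 * l + 1) * (G w ^ 2 / 4)) w := by
    intro w
    have hGw := hasDerivAt_besselEntire (𝕜 := ℝ) l w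
    have hG1w := hasDerivAt_besselEntireDeriv (𝕜 := ℝ) l w
    have hode : w * G₂ w = G w / 4 - ((l : ℝ) + 3 / 2) * G₁ w := by
      linarith [besselEntire_ode l w]
    have := ((hasDerivAt_neg w).pow (2 * l + 2)).mul
      (((hGw.pow 2).div_const 4).sub ((hasDerivAt_id w).mul (hG1w.pow 2)))
    convert! this using 1
    simp only [Pi.pow_apply, Pi.mul_apply, Pi.sub_apply, id,
      show 2 * l + 2 - 1 = 2 * l + 1 from rfl, show 2 - 1 = 1 from rfl]
    push_cast
    have e1 : (-w) ^ (2 * l + 2) = (-w) ^ (2 * l + 1) * (-w) := pow_succ _ _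
    rw [e1]
    linear_combination (exp := 1) (-(-w) ^ (2 * l + 1) * (-w) * (-2) * G₁ w) * hode
  have hanti : AntitoneOn Φ (Set.Icc w₀ 0) := by
    refine antitoneOn_of_deriv_nonpos (convex_Icc _ _)
      (fun w _ => (hd w).continuousAt.continuousWithinAt)
      (fun w _ => (hd w).differentiableAt.differentiableWithinAt) fun w hw => ?_
    rw [interior_Icc] at hw
    rw [(hd w).deriv]
    have : 0 < -w := by linarith [hw.2]
    have h3 : 0 ≤ (2 * (l : ℝ) + 2) * (-w) ^ (2 * l + 1) * (G w ^ 2 / 4) := by positivity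
    linarith
  have hΦ0 : Φ w₀ = 0 := by
    have : w₀ * G₁ w₀ ^ 2 = 0 := by rw [pow_two, ← mul_assoc, h1, zero_mul]
    simp [Φ, this, h0]
  rcases hw₀.eq_or_lt with rfl | hlt
  · exact hpos.ne' h0
  have hev : ∀ᶠ w in 𝓝[<] (0 : ℝ), 0 < G w :=
    ((continuous_besselEntire (𝕜 := ℝ) l).continuousAt.eventually (lt_mem_nhds hpos)).filter_mono
      nhdsWithin_le_nhds
  obtain ⟨w, hw, hwm⟩ := (hev.and (Ioo_mem_nhdsLT hlt)).exists
  have hle := hanti (Set.left_mem_Icc.2 hlt.le) ⟨hwm.1.le, hwm.2.le⟩ hwm.1.le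
  rw [hΦ0] at hle
  have hw2 : 0 < -w := by linarith [hwm.2]
  have : 0 < Φ w := by
    have : 0 ≤ -w * G₁ w ^ 2 := by positivity
    have : 0 < G w ^ 2 / 4 - w * G₁ w ^ 2 := by
      have : 0 < G w ^ 2 / 4 := by positivity
      linarith
    exact mul_pos (pow_pos hw2 _) this
  linarith

/-! ### The function f in terms of the entire function -/

theorem besselIHalf_eq (z : ℂ) :
    besselIHalf l z = (z / 2) ^ ((l : ℂ) + 1 / 2) * besselEntire ℂ l (z ^ 2) := by
  rw [besselIHalf, besselI, besselEntire, scalarSeries]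
  congr 1
  refine tsum_congr fun k => ?_
  have : Complex.Gamma ((l : ℂ) + 1 / 2 + k + 1)
      = ((Real.Gamma ((l : ℝ) + 1 / 2 + k + 1) : ℝ) : ℂ) := by
    rw [← Complex.Gamma_ofReal]
    push_cast
    rfl
  rw [this, besselCoeff, pow_mul, div_pow, div_pow]
  push_cast
  norm_num
  ring

theorem hasDerivAt_besselIHalf {z : ℂ} (hz : z ∈ Complex.slitPlane) :
    HasDerivAt (besselIHalf l)
      ((z / 2) ^ ((l : ℂ) + 1 / 2) / z * (((l : ℂ) + 1 / 2) * besselEntire ℂ l (z ^ 2)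
        + 2 * z ^ 2 * besselEntireDeriv ℂ l (z ^ 2))) z := by
  have hz0 : z ≠ 0 := Complex.slitPlane_ne_zero hz
  have hz2 : z / 2 ∈ Complex.slitPlane := by
    rw [Complex.mem_slitPlane_iff] at hz ⊢
    simpa using hz
  have h1 : HasDerivAt (fun z : ℂ => (z / 2) ^ ((l : ℂ) + 1 / 2))
      (((l : ℂ) + 1 / 2) * (z / 2) ^ ((l : ℂ) + 1 / 2 - 1) * (1 / 2)) z :=
    ((hasDerivAt_id z).div_const 2).cpow_const hz2
  have h2 : HasDerivAt (fun z : ℂ => besselEntire ℂ l (z ^ 2))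
      (besselEntireDeriv ℂ l (z ^ 2) * (2 * z)) z := by
    have := (hasDerivAt_besselEntire (𝕜 := ℂ) l (z ^ 2)).comp z (hasDerivAt_pow 2 z)
    simpa using! this
  have h3 := h1.mul h2
  have : besselIHalf l = fun z => (z / 2) ^ ((l : ℂ) + 1 / 2) * besselEntire ℂ l (z ^ 2) :=
    funext (besselIHalf_eq l)
  rw [this]
  convert! h3 using 1
  rw [Complex.cpow_sub _ _ (by simpa using hz0), Complex.cpow_one]
  field_simp

theorem half_cpow_ne_zero {z : ℂ} (hz0 : z ≠ 0) : (z / 2) ^ ((l : ℂ) + 1 / 2) ≠ 0 := by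
  rw [Complex.cpow_ne_zero_iff_of_exponent_ne_zero]
  · simpa using hz0
  · intro h
    have := congrArg Complex.re h
    simp at this
    have h3 : (0 : ℝ) ≤ l := by positivity
    norm_num at this
    linarith

/-- The branch-dependent power (z/2)^ν cancels between numerator and denominator, leaving a function
of z² alone. This gives both the limit at 0 and the reality of f on the imaginary axis. -/
theorem efimovF_eq {z : ℂ} (hz : z ∈ Complex.slitPlane) :
    efimovF l z = besselEntire ℂ l (z ^ 2) / (2 * (((l : ℂ) + 1 / 2) * besselEntire ℂ l (z ^ 2)
        + 2 * z ^ 2 * besselEntireDeriv ℂ l (z ^ 2))) := by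
  have hz0 : z ≠ 0 := Complex.slitPlane_ne_zero hz
  have hp := half_cpow_ne_zero l hz0
  rw [efimovF, (hasDerivAt_besselIHalf l hz).deriv, besselIHalf_eq]
  generalize ((l : ℂ) + 1 / 2) * besselEntire ℂ l (z ^ 2)
        + 2 * z ^ 2 * besselEntireDeriv ℂ l (z ^ 2) = D
  rw [show 2 * z * ((z / 2) ^ ((l : ℂ) + 1 / 2) / z * D) = (z / 2) ^ ((l : ℂ) + 1 / 2) * (2 * D) by
    field_simp, mul_div_mul_left _ _ hp]

theorem tendsto_efimovF :
    Tendsto (efimovF l) (𝓝[Complex.slitPlane] 0) (𝓝 (1 / (2 * (l : ℂ) + 1))) := by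
  have hcont : Tendsto (fun z : ℂ => besselEntire ℂ l (z ^ 2) /
      (2 * (((l : ℂ) + 1 / 2) * besselEntire ℂ l (z ^ 2)
        + 2 * z ^ 2 * besselEntireDeriv ℂ l (z ^ 2)))) (𝓝 0) (𝓝 (1 / (2 * (l : ℂ) + 1))) := by
    have hl : (2 * (l : ℂ) + 1) ≠ 0 := by exact_mod_cast Nat.succ_ne_zero (2 * l)
    have hG0 : besselEntire ℂ l 0 ≠ 0 := by
      rw [besselEntire, scalarSeries_zero]
      exact Complex.ofReal_ne_zero.2 (besselCoeff_pos l 0).ne'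
    have hval : (2 * (((l : ℂ) + 1 / 2) * besselEntire ℂ l ((0 : ℂ) ^ 2)
        + 2 * (0 : ℂ) ^ 2 * besselEntireDeriv ℂ l ((0 : ℂ) ^ 2)))
        = (2 * (l : ℂ) + 1) * besselEntire ℂ l 0 := by
      rw [zero_pow two_ne_zero]
      ring
    have hc := continuous_besselEntire (𝕜 := ℂ) l
    have hc1 := continuous_besselEntireDeriv (𝕜 := ℂ) l
    have : ContinuousAt (fun z : ℂ => besselEntire ℂ l (z ^ 2) /
      (2 * (((l : ℂ) + 1 / 2) * besselEntire ℂ l (z ^ 2)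
        + 2 * z ^ 2 * besselEntireDeriv ℂ l (z ^ 2)))) 0 := by
      refine ContinuousAt.div (by fun_prop) (by fun_prop) ?_
      rw [hval]
      exact mul_ne_zero hl hG0
    have h2 := this.tendsto
    rw [hval, zero_pow two_ne_zero] at h2
    convert h2 using 2
    field_simp
  refine (hcont.mono_left nhdsWithin_le_nhds).congr' ?_
  filter_upwards [self_mem_nhdsWithin] with z hz using (efimovF_eq l hz).symm

end entire

/-! ### Integral representation of the Macdonald function -/

/-- The integrand `t^{iβ-n} e^{-t-y/t}`. -/
noncomputable def macdonaldKernel (β : ℝ) (n : ℕ) (y t : ℝ) : ℂ :=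
  (t : ℂ) ^ (Complex.I * β - n) * (Real.exp (-t - y / t) : ℝ)

/-- `∫₀^∞ t^{iβ-n} e^{-t-y/t} dt`. -/
noncomputable def macdonaldIntegral (β : ℝ) (n : ℕ) (y : ℝ) : ℂ :=
  ∫ t in Set.Ioi (0 : ℝ), macdonaldKernel β n y t

section macdonald

variable (β : ℝ) (n : ℕ)

theorem norm_macdonaldKernel {t : ℝ} (ht : 0 < t) (y : ℝ) :
    ‖macdonaldKernel β n y t‖ = (t ^ n)⁻¹ * Real.exp (-t - y / t) := by
  rw [macdonaldKernel, norm_mul, Complex.norm_cpow_eq_rpow_re_of_pos ht, Complex.norm_real,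
    Real.norm_of_nonneg (Real.exp_pos _).le]
  simp [Real.rpow_neg ht.le]

/-- The singularity t^{-n} is absorbed by e^{-y/t}, since e^s ≥ s^n/n! at s = y/t. -/
theorem norm_macdonaldKernel_le {t y : ℝ} (ht : 0 < t) (hy : 0 < y) :
    ‖macdonaldKernel β n y t‖ ≤ n.factorial / y ^ n * Real.exp (-t) := by
  rw [norm_macdonaldKernel β n ht, sub_eq_add_neg, Real.exp_add, Real.exp_neg (y / t)]
  have h := Real.pow_div_factorial_le_exp (y / t) (by positivity) n
  have hn : (0 : ℝ) < n.factorial := by positivity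
  rw [div_pow, div_le_iff₀ hn] at h
  have : (t ^ n)⁻¹ * (Real.exp (y / t))⁻¹ ≤ n.factorial / y ^ n := by
    rw [← mul_inv, inv_le_comm₀ (by positivity) (by positivity), inv_div, div_le_iff₀ hn]
    rw [div_le_iff₀ (by positivity)] at h
    linarith
  calc _ = (t ^ n)⁻¹ * (Real.exp (y / t))⁻¹ * Real.exp (-t) := by ring
    _ ≤ _ := by gcongr

theorem norm_macdonaldKernel_zero_le {t y : ℝ} (ht : 0 < t) (hy : 0 ≤ y) :
    ‖macdonaldKernel β 0 y t‖ ≤ Real.exp (-t) := by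
  rw [norm_macdonaldKernel β 0 ht, pow_zero, inv_one, one_mul]
  gcongr
  have : 0 ≤ y / t := by positivity
  linarith

theorem continuousOn_macdonaldKernel (y : ℝ) :
    ContinuousOn (macdonaldKernel β n y) (Set.Ioi 0) := by
  intro t ht
  have ht' : (0 : ℝ) < t := ht
  unfold macdonaldKernel
  have h1 : ContinuousAt (fun t : ℝ => (t : ℂ) ^ (Complex.I * β - n)) t :=
    (continuousAt_cpow_const (Or.inl (by simpa using ht'))).comp
      Complex.continuous_ofReal.continuousAt
  have h2 : ContinuousAt (fun t : ℝ => ((Real.exp (-t - y / t) : ℝ) : ℂ)) t := by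
    refine Complex.continuous_ofReal.continuousAt.comp (Real.continuous_exp.continuousAt.comp ?_)
    exact (continuousAt_neg).sub (continuousAt_const.div continuousAt_id ht'.ne')
  exact (h1.mul h2).continuousWithinAt

theorem aestronglyMeasurable_macdonaldKernel (y : ℝ) :
    AEStronglyMeasurable (macdonaldKernel β n y) (volume.restrict (Set.Ioi 0)) :=
  (continuousOn_macdonaldKernel β n y).aestronglyMeasurable measurableSet_Ioi

theorem integrableOn_exp_neg : IntegrableOn (fun t : ℝ => Real.exp (-t)) (Set.Ioi 0) := by
  simpa using integrableOn_exp_mul_Ioi (a := -1) (by norm_num) 0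

theorem integrableOn_macdonaldKernel {y : ℝ} (hy : 0 < y) :
    IntegrableOn (macdonaldKernel β n y) (Set.Ioi 0) := by
  refine Integrable.mono' (integrableOn_exp_neg.const_mul (n.factorial / y ^ n))
    (aestronglyMeasurable_macdonaldKernel β n y) ?_
  filter_upwards [self_mem_ae_restrict measurableSet_Ioi] with t ht
  exact norm_macdonaldKernel_le β n ht hy

theorem hasDerivAt_macdonaldIntegral {y : ℝ} (hy : 0 < y) :
    HasDerivAt (macdonaldIntegral β n) (-macdonaldIntegral β (n + 1) y) y := by
  have hy2 : 0 < y / 2 := by positivity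
  have key := (hasDerivAt_integral_of_dominated_loc_of_deriv_le (μ := volume.restrict (Set.Ioi 0))
    (F := macdonaldKernel β n) (F' := fun y t => -macdonaldKernel β (n + 1) y t)
    (x₀ := y) (s := Set.Ioi (y / 2))
    (bound := fun t => (n + 1).factorial / (y / 2) ^ (n + 1) * Real.exp (-t))
    (Ioi_mem_nhds (by linarith))
    (Eventually.of_forall fun y => aestronglyMeasurable_macdonaldKernel β n y)
    (integrableOn_macdonaldKernel β n hy)
    (aestronglyMeasurable_macdonaldKernel β (n + 1) y).neg ?_
    (integrableOn_exp_neg.const_mul _) ?_).2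
  · rw [integral_neg] at key
    exact key
  · filter_upwards [self_mem_ae_restrict measurableSet_Ioi] with t ht z hz
    rw [norm_neg]
    refine (norm_macdonaldKernel_le β (n + 1) ht (hy2.trans hz)).trans ?_
    have : y / 2 ≤ z := le_of_lt hz
    gcongr
  · filter_upwards [self_mem_ae_restrict measurableSet_Ioi] with t ht z _
    have ht' : (0 : ℝ) < t := ht
    have h1 : HasDerivAt (fun z : ℝ => Real.exp (-t - z / t))
        (Real.exp (-t - z / t) * (-(1 / t))) z :=
      (((hasDerivAt_id z).div_const t).const_sub (-t)).exp
    have h2 := h1.ofReal_comp.const_mul ((t : ℂ) ^ (Complex.I * β - n))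
    convert! h2 using 1
    have htc : (t : ℂ) ≠ 0 := by exact_mod_cast ht'.ne'
    have : Complex.I * (β : ℂ) - ((n + 1 : ℕ) : ℂ) = Complex.I * β - n - 1 := by push_cast; ring
    rw [macdonaldKernel, this, Complex.cpow_sub _ _ htc, Complex.cpow_one]
    push_cast
    field_simp

/-- The integrand of the left side is the t-derivative of the kernel with n = 0, which vanishes at
both ends of (0, ∞). -/
theorem macdonaldIntegral_recurrence {β : ℝ} (hβ : β ≠ 0) {y : ℝ} (hy : 0 < y) :
    Complex.I * β * macdonaldIntegral β 1 y - macdonaldIntegral β 0 y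
      + y * macdonaldIntegral β 2 y = 0 := by
  have hIβ : Complex.I * (β : ℂ) ≠ 0 := mul_ne_zero Complex.I_ne_zero (by exact_mod_cast hβ)
  have hd : ∀ t ∈ Set.Ioi (0 : ℝ), HasDerivAt (macdonaldKernel β 0 y)
      (Complex.I * β * macdonaldKernel β 1 y t - macdonaldKernel β 0 y t
        + y * macdonaldKernel β 2 y t) t := by
    intro t ht
    have ht' : (0 : ℝ) < t := ht
    have htc : (t : ℂ) ≠ 0 := by exact_mod_cast ht'.ne'
    have h0 : HasDerivAt (fun t : ℝ => (t : ℂ) ^ (Complex.I * (β : ℂ) - (0 : ℕ)))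
        ((Complex.I * β - (0 : ℕ)) * (t : ℂ) ^ (Complex.I * (β : ℂ) - (0 : ℕ) - 1)) t := by
      have := (((hasDerivAt_id (t : ℂ)).cpow_const (c := Complex.I * (β : ℂ) - (0 : ℕ))
        (by simpa using ht'))).comp_ofReal
      simpa using! this
    have h1 : HasDerivAt (fun t : ℝ => Real.exp (-t - y / t))
        (Real.exp (-t - y / t) * (-1 - (-y / t ^ 2))) t := by
      have h := (hasDerivAt_neg t).sub ((hasDerivAt_inv ht'.ne').const_mul y)
      have h' : HasDerivAt (fun t : ℝ => -t - y / t) (-1 - (-y / t ^ 2)) t := by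
        convert! h using 1
        ring
      exact h'.exp
    have h2 := h0.mul h1.ofReal_comp
    convert! h2 using 1
    simp only [macdonaldKernel]
    rw [Complex.cpow_sub _ _ htc, Complex.cpow_sub _ _ htc, Complex.cpow_sub _ _ htc,
      Complex.cpow_sub _ _ htc]
    simp only [Complex.cpow_natCast, Complex.cpow_one]
    push_cast
    field_simp
    ring_nf
  have i0 := integrableOn_macdonaldKernel β 0 hy
  have i1 := (integrableOn_macdonaldKernel β 1 hy).const_mul (Complex.I * β)
  have i2 := (integrableOn_macdonaldKernel β 2 hy).const_mul (y : ℂ)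
  have hint : IntegrableOn (fun t => Complex.I * β * macdonaldKernel β 1 y t
      - macdonaldKernel β 0 y t + y * macdonaldKernel β 2 y t) (Set.Ioi 0) := (i1.sub i0).add i2
  -- The value at t = 0 is 0 only because 0^{iβ} = 0 for β ≠ 0; the exponential factor there is 1,
  -- as y / 0 = 0.
  have hval : macdonaldKernel β 0 y 0 = 0 := by
    rw [macdonaldKernel, Complex.ofReal_zero, Nat.cast_zero, sub_zero, Complex.zero_cpow hIβ,
      zero_mul]
  have hcont : ContinuousWithinAt (macdonaldKernel β 0 y) (Set.Ici 0) 0 := by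
    rw [ContinuousWithinAt, hval]
    refine squeeze_zero_norm' (a := fun t => t / y) ?_ ?_
    · filter_upwards [self_mem_nhdsWithin] with t ht
      rcases (show (0 : ℝ) ≤ t from ht).eq_or_lt with rfl | ht'
      · simp [hval]
      · have h := norm_macdonaldKernel_le β 1 ht' hy
        rw [norm_macdonaldKernel β 1 ht'] at h
        rw [norm_macdonaldKernel β 0 ht']
        simp only [pow_one, Nat.factorial_one, Nat.cast_one, pow_zero, inv_one, one_mul] at h ⊢
        rw [inv_mul_le_iff₀ ht'] at h
        refine h.trans ?_
        have : Real.exp (-t) ≤ 1 := Real.exp_le_one_iff.2 (by linarith)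
        calc t * (1 / y * Real.exp (-t)) ≤ t * (1 / y * 1) := by gcongr
          _ = t / y := by ring
    · have : Tendsto (fun t : ℝ => t / y) (𝓝 0) (𝓝 (0 / y)) := tendsto_id.div_const y
      rw [zero_div] at this
      exact this.mono_left nhdsWithin_le_nhds
  have htop : Tendsto (macdonaldKernel β 0 y) atTop (𝓝 0) := by
    refine squeeze_zero_norm' ?_ Real.tendsto_exp_neg_atTop_nhds_zero
    filter_upwards [eventually_gt_atTop 0] with t ht
    exact norm_macdonaldKernel_zero_le β ht hy.le
  have key := integral_Ioi_of_hasDerivAt_of_tendsto hcont hd hint htop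
  have e1 := integral_add (i1.sub i0) i2
  have e2 := integral_sub i1 i0
  simp only [Pi.sub_apply] at e1
  rw [hval, sub_zero, e1, e2, integral_const_mul, integral_const_mul] at key
  exact key

/-- The substitution t ↦ y/t fixes e^{-t-y/t} and turns t^{iβ-2} dt into y^{iβ-1} t^{-iβ} dt; it is
carried out through the Mellin transform. -/
theorem macdonaldIntegral_reflect {y : ℝ} (hy : 0 < y) :
    y * macdonaldIntegral β 2 y
      = (y : ℂ) ^ (Complex.I * (β : ℂ)) * (starRingEnd ℂ) (macdonaldIntegral β 0 y) := by
  let f : ℝ → ℂ := fun t => ((Real.exp (-t - y / t) : ℝ) : ℂ)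
  have hf : f = fun t => (fun u => f (y * u)) t⁻¹ := by
    funext t
    rcases eq_or_ne t 0 with rfl | ht
    · simp [f]
    · simp only [f]
      congr 2
      field_simp
      ring
  have h2 : macdonaldIntegral β 2 y = mellin f (Complex.I * β - 1) := by
    rw [macdonaldIntegral, mellin]
    refine integral_congr_ae (Eventually.of_forall fun t => ?_)
    simp only [macdonaldKernel, smul_eq_mul, f]
    congr 2
    push_cast
    ring
  have h0 : (starRingEnd ℂ) (macdonaldIntegral β 0 y) = mellin f (-(Complex.I * β - 1)) := by
    rw [macdonaldIntegral, mellin, ← integral_conj]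
    refine setIntegral_congr_fun measurableSet_Ioi fun t ht => ?_
    have ht' : (0 : ℝ) < t := ht
    simp only [macdonaldKernel, smul_eq_mul, f, map_mul, Complex.conj_ofReal]
    congr 1
    have hc := Complex.cpow_conj (t : ℂ) (Complex.I * β - (0 : ℕ))
      (by rw [Complex.arg_ofReal_of_nonneg ht'.le]; exact Real.pi_pos.ne)
    rw [Complex.conj_ofReal] at hc
    rw [← hc]
    simp only [Complex.conj_ofReal, map_sub, map_mul, Complex.conj_I, map_natCast]
    congr 1
    push_cast
    ring
  have hyc : (y : ℂ) ≠ 0 := by exact_mod_cast hy.ne'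
  have h3 : mellin f (Complex.I * β - 1)
      = (y : ℂ) ^ (Complex.I * (β : ℂ) - 1) * mellin f (-(Complex.I * β - 1)) := by
    have h := mellin_comp_inv (fun u => f (y * u)) (Complex.I * β - 1)
    rwa [← hf, mellin_comp_mul_left f _ hy, neg_neg, smul_eq_mul] at h
  rw [h2, h0, h3, Complex.cpow_sub _ _ hyc, Complex.cpow_one]
  field_simp

theorem tendsto_macdonaldIntegral_zero :
    Tendsto (macdonaldIntegral β 0) (𝓝[>] 0) (𝓝 (Complex.Gamma (1 + Complex.I * β))) := by
  have hG : Complex.Gamma (1 + Complex.I * β)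
      = ∫ t in Set.Ioi (0 : ℝ), macdonaldKernel β 0 0 t := by
    rw [Complex.Gamma_eq_integral (by simp), Complex.GammaIntegral]
    refine integral_congr_ae (Eventually.of_forall fun t => ?_)
    simp [macdonaldKernel, mul_comm]
  rw [hG]
  refine tendsto_integral_filter_of_dominated_convergence (fun t => Real.exp (-t))
    (Eventually.of_forall fun y => aestronglyMeasurable_macdonaldKernel β 0 y) ?_
    integrableOn_exp_neg ?_
  · filter_upwards [self_mem_nhdsWithin] with y hy
    filter_upwards [self_mem_ae_restrict measurableSet_Ioi] with t ht
    exact norm_macdonaldKernel_zero_le β ht (le_of_lt hy)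
  · refine Eventually.of_forall fun t => ?_
    have : Continuous fun y => macdonaldKernel β 0 y t := by
      unfold macdonaldKernel
      fun_prop
    exact (this.tendsto 0).mono_left nhdsWithin_le_nhds

/-- Since (t - x)² + t² ≥ 0, one has t + x²/(4t) ≥ t/2 + x/2 for t > 0. -/
theorem norm_macdonaldIntegral_le (x : ℝ) :
    ‖macdonaldIntegral β 0 (x ^ 2 / 4)‖ ≤ 2 * Real.exp (-(x / 2)) := by
  have hi : IntegrableOn (fun t : ℝ => Real.exp (-(1 / 2) * t)) (Set.Ioi 0) :=
    integrableOn_exp_mul_Ioi (a := -(1 / 2)) (by norm_num) 0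
  have hb := norm_integral_le_of_norm_le (μ := volume.restrict (Set.Ioi 0))
    (f := macdonaldKernel β 0 (x ^ 2 / 4)) (hi.const_mul (Real.exp (-(x / 2)))) (by
      filter_upwards [self_mem_ae_restrict measurableSet_Ioi] with t ht
      have ht' : (0 : ℝ) < t := ht
      rw [norm_macdonaldKernel β 0 ht, pow_zero, inv_one, one_mul, ← Real.exp_add]
      gcongr
      have : 0 ≤ (2 * t ^ 2 + x ^ 2 - 2 * t * x) / (4 * t) := by
        apply div_nonneg _ (by positivity)
        nlinarith [sq_nonneg (t - x), sq_nonneg t]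
      have h2 : (2 * t ^ 2 + x ^ 2 - 2 * t * x) / (4 * t) = t / 2 + x ^ 2 / 4 / t - x / 2 := by
        field_simp
        ring
      linarith)
  refine hb.trans (le_of_eq ?_)
  rw [integral_const_mul, integral_exp_mul_Ioi (by norm_num)]
  norm_num
  ring

/-! ### The first-order system for x K_{1+iβ}(x) -/

/-- `x K_{1+iβ}(x)`, where `K` is the Macdonald function. -/
noncomputable def macdonaldH (β x : ℝ) : ℂ :=
  Complex.exp (-(Complex.I * β * Real.log (x / 2))) * macdonaldIntegral β 0 (x ^ 2 / 4)

theorem norm_macdonaldH_le (x : ℝ) :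
    ‖macdonaldH β x‖ ≤ 2 * Real.exp (-(x / 2)) := by
  have : ‖Complex.exp (-(Complex.I * β * Real.log (x / 2)))‖ = 1 := by
    rw [Complex.norm_exp]
    simp
  rw [macdonaldH, norm_mul, this, one_mul]
  exact norm_macdonaldIntegral_le β x

/-- Differentiation brings in the integral with n = 1. Recurrence and reflection express it by H and
its conjugate, namely Im H = (β/2) e^{-iβ log(x/2)} times that integral, so the system for Re H and
Im H closes. -/
theorem hasDerivAt_macdonaldH {β : ℝ} (hβ : β ≠ 0) {x : ℝ} (hx : 0 < x) :
    HasDerivAt (macdonaldH β) (-(Complex.I * β) / x * macdonaldH β x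
      - ((x / β * (macdonaldH β x).im : ℝ) : ℂ)) x := by
  have hβc : (β : ℂ) ≠ 0 := by exact_mod_cast hβ
  have hxc : (x : ℂ) ≠ 0 := by exact_mod_cast hx.ne'
  have hy : 0 < x ^ 2 / 4 := by positivity
  set θ : ℝ := β * Real.log (x / 2) with hθ
  set e : ℂ := Complex.exp (-(Complex.I * β * Real.log (x / 2))) with he
  have hlog : HasDerivAt (fun x : ℝ => Real.log (x / 2)) (1 / x) x := by
    have h := ((hasDerivAt_id x).div_const 2).log (by simpa using hx.ne')
    convert! h using 1
    simp only [id]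
    field_simp
  have he' : HasDerivAt (fun x : ℝ => Complex.exp (-(Complex.I * β * Real.log (x / 2))))
      (e * (-(Complex.I * β * ((1 / x : ℝ) : ℂ)))) x :=
    ((hlog.ofReal_comp.const_mul (Complex.I * (β : ℂ))).neg).cexp
  have hq : HasDerivAt (fun x : ℝ => x ^ 2 / 4) (x / 2) x := by
    have := (hasDerivAt_pow 2 x).div_const 4
    convert! this using 1
    norm_num
    ring
  have hA : HasDerivAt (fun x : ℝ => macdonaldIntegral β 0 (x ^ 2 / 4))
      ((x / 2 : ℝ) • -macdonaldIntegral β 1 (x ^ 2 / 4)) x :=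
    HasDerivAt.scomp (g₁ := macdonaldIntegral β 0) (h := fun x : ℝ => x ^ 2 / 4) x
      (hasDerivAt_macdonaldIntegral β 0 hy) hq
  have hmul := he'.mul hA
  have hrec := macdonaldIntegral_recurrence hβ hy
  rw [macdonaldIntegral_reflect β hy] at hrec
  have hpow : ((x ^ 2 / 4 : ℝ) : ℂ) ^ (Complex.I * (β : ℂ))
      = Complex.exp (Complex.I * β * Real.log (x / 2)) ^ 2 := by
    rw [Complex.cpow_def_of_ne_zero (by exact_mod_cast hy.ne'), ← Complex.ofReal_log hy.le,
      show x ^ 2 / 4 = (x / 2) ^ 2 by ring, Real.log_pow, ← Complex.exp_nat_mul]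
    congr 1
    push_cast
    ring
  rw [hpow] at hrec
  have hee : Complex.exp (Complex.I * β * Real.log (x / 2)) * e = 1 := by
    rw [he, ← Complex.exp_add, add_neg_cancel, Complex.exp_zero]
  have hconj : (starRingEnd ℂ) (macdonaldH β x)
      = Complex.exp (Complex.I * β * Real.log (x / 2))
        * (starRingEnd ℂ) (macdonaldIntegral β 0 (x ^ 2 / 4)) := by
    rw [macdonaldH, map_mul, ← Complex.exp_conj]
    congr 2
    simp
  have him : (((macdonaldH β x).im : ℝ) : ℂ) * (2 * Complex.I)
      = macdonaldH β x - (starRingEnd ℂ) (macdonaldH β x) := by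
    rw [Complex.sub_conj]
    push_cast
    ring
  have hH : macdonaldH β x = e * macdonaldIntegral β 0 (x ^ 2 / 4) := rfl
  convert! hmul using 1
  have him2 : (((macdonaldH β x).im : ℝ) : ℂ)
      = β / 2 * e * macdonaldIntegral β 1 (x ^ 2 / 4) := by
    apply mul_right_cancel₀ (mul_ne_zero two_ne_zero Complex.I_ne_zero)
    rw [him, hconj, hH]
    generalize Complex.exp (Complex.I * β * Real.log (x / 2)) = g at hrec hee
    linear_combination (-e) * hrec +
      g * (starRingEnd ℂ) (macdonaldIntegral β 0 (x ^ 2 / 4)) * hee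
  rw [Complex.ofReal_mul, him2, hH, Complex.real_smul]
  push_cast
  field_simp
  ring

theorem hasDerivAt_macdonaldH_im {β : ℝ} (hβ : β ≠ 0) {x : ℝ} (hx : 0 < x) :
    HasDerivAt (fun x => (macdonaldH β x).im) (-β / x * (macdonaldH β x).re) x := by
  have h := (Complex.imCLM.hasFDerivAt.comp_hasDerivAt x (hasDerivAt_macdonaldH hβ hx))
  convert! h using 1
  have hx' := hx.ne'
  simp only [Complex.imCLM_apply, Complex.sub_im, Complex.mul_im, Complex.div_im, Complex.div_re,
    Complex.ofReal_re, Complex.ofReal_im, Complex.normSq_ofReal, Complex.neg_re, Complex.neg_im,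
    Complex.mul_re, Complex.I_re, Complex.I_im]
  field_simp
  ring

theorem hasDerivAt_macdonaldH_re {β : ℝ} (hβ : β ≠ 0) {x : ℝ} (hx : 0 < x) :
    HasDerivAt (fun x => (macdonaldH β x).re) ((β / x - x / β) * (macdonaldH β x).im) x := by
  have h := (Complex.reCLM.hasFDerivAt.comp_hasDerivAt x (hasDerivAt_macdonaldH hβ hx))
  convert! h using 1
  have hx' := hx.ne'
  simp only [Complex.reCLM_apply, Complex.sub_re, Complex.mul_im, Complex.div_im, Complex.div_re,
    Complex.ofReal_re, Complex.ofReal_im, Complex.normSq_ofReal, Complex.neg_re, Complex.neg_im,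
    Complex.mul_re, Complex.I_re, Complex.I_im]
  field_simp
  ring

theorem continuousOn_macdonaldIntegral : ContinuousOn (macdonaldIntegral β n) (Set.Ioi 0) :=
  fun _ hy => (hasDerivAt_macdonaldIntegral β n hy).continuousAt.continuousWithinAt

end macdonald

/-! ### Solving the phase equation -/

/-- If `Q` is continuous on `(0, ∞)` with a positive limit at `0`, then
`Q x * exp (i (γ - β log (x / 2)))` is real along a sequence `xₙ → 0` with
`β log (xₙ / 2) = γ - n π + o(1)`. -/
theorem exists_phase_sequence {Q : ℝ → ℂ} {c β γ : ℝ} (hβ : 0 < β) (hc : 0 < c)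
    (hQ : ContinuousOn Q (Set.Ioi 0)) (hlim : Tendsto Q (𝓝[>] 0) (𝓝 (c : ℂ))) :
    ∃ x δ : ℕ → ℝ, Tendsto x atTop (𝓝[>] 0) ∧ Tendsto δ atTop (𝓝 0) ∧
      ∀ᶠ n : ℕ in atTop,
        (Q (x n) * Complex.exp (Complex.I * (γ - β * Real.log (x n / 2) : ℝ))).im = 0 ∧
          β * Real.log (x n / 2) = γ - n * Real.pi + δ n := by
  have hcs : (c : ℂ) ∈ Complex.slitPlane := by simpa using hc
  have hev := hlim.eventually (Complex.isOpen_slitPlane.mem_nhds hcs)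
  obtain ⟨x₀, hx₀, hslit⟩ := mem_nhdsGT_iff_exists_Ioo_subset.1 hev
  have hx₀' : (0 : ℝ) < x₀ := hx₀
  set s₁ : ℝ := Real.log (x₀ / 2) - 1 with hs₁
  have hlt : ∀ s ≤ s₁, 2 * Real.exp s < x₀ := by
    intro s hs
    have : Real.exp s < x₀ / 2 := by
      rw [← Real.lt_log_iff_exp_lt (by positivity)]
      linarith
    linarith
  have hmem : ∀ s ≤ s₁, Q (2 * Real.exp s) ∈ Complex.slitPlane :=
    fun s hs => hslit ⟨by positivity, hlt s hs⟩
  -- In the variable s = log(x/2), the equation h(s) = γ - nπ says that the total phase is exactly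
  -- nπ.
  let h : ℝ → ℝ := fun s => β * s - Complex.arg (Q (2 * Real.exp s))
  have hcont : ∀ a, ContinuousOn h (Set.Icc a s₁) := by
    intro a s hs
    have h1 : ContinuousAt Q (2 * Real.exp s) := hQ.continuousAt (Ioi_mem_nhds (by positivity))
    have h2 : ContinuousAt (fun s => Q (2 * Real.exp s)) s :=
      ContinuousAt.comp (f := fun s => 2 * Real.exp s) h1 (by fun_prop)
    have h3 : ContinuousAt (fun s => Complex.arg (Q (2 * Real.exp s))) s :=
      ContinuousAt.comp (f := fun s => Q (2 * Real.exp s)) (g := Complex.arg)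
        (Complex.continuousAt_arg (hmem s hs.2)) h2
    exact ((continuousAt_const.mul continuousAt_id).sub h3).continuousWithinAt
  have hroot : ∀ n : ℕ, ∃ s, γ - n * Real.pi ≤ h s₁ → h s = γ - n * Real.pi := by
    intro n
    by_cases hn : γ - n * Real.pi ≤ h s₁
    -- The extra -π compensates for the argument, which exceeds -π, so that h(s₂) lies below the
    -- target.
    · set s₂ := min s₁ ((γ - n * Real.pi - Real.pi) / β)
      have hs₂ : h s₂ ≤ γ - n * Real.pi := by
        have h1 : β * s₂ ≤ γ - n * Real.pi - Real.pi := by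
          have : s₂ ≤ (γ - n * Real.pi - Real.pi) / β := min_le_right _ _
          rw [le_div_iff₀ hβ] at this
          linarith
        have h2 := Complex.neg_pi_lt_arg (Q (2 * Real.exp s₂))
        simp only [h]
        linarith
      obtain ⟨s, -, hs⟩ := intermediate_value_Icc (min_le_left _ _) (hcont s₂) ⟨hs₂, hn⟩
      exact ⟨s, fun _ => hs⟩
    · exact ⟨0, fun h => absurd h hn⟩
  choose s hs using hroot
  have hto : Tendsto (fun n : ℕ => γ - n * Real.pi) atTop atBot := by
    have : Tendsto (fun n : ℕ => (n : ℝ) * Real.pi) atTop atTop :=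
      tendsto_natCast_atTop_atTop.atTop_mul_const Real.pi_pos
    simpa [sub_eq_add_neg] using
      tendsto_atBot_add_const_left atTop γ (tendsto_neg_atTop_atBot.comp this)
  have hroot : ∀ᶠ n : ℕ in atTop, h (s n) = γ - n * Real.pi := by
    filter_upwards [hto.eventually (eventually_le_atBot (h s₁))] with n hn using hs n hn
  have hsbot : Tendsto s atTop atBot := by
    have h1 : Tendsto (fun n : ℕ => (γ - n * Real.pi + Real.pi) / β) atTop atBot :=
      (tendsto_atBot_add_const_right atTop Real.pi hto).atBot_div_const hβ
    refine tendsto_atBot_mono' atTop ?_ h1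
    filter_upwards [hroot] with n hn
    rw [le_div_iff₀ hβ]
    have := Complex.arg_le_pi (Q (2 * Real.exp (s n)))
    simp only [h] at hn
    linarith
  have hx : Tendsto (fun n => 2 * Real.exp (s n)) atTop (𝓝[>] 0) := by
    refine tendsto_nhdsWithin_iff.2 ⟨?_, Eventually.of_forall fun n => ?_⟩
    · simpa using (Real.tendsto_exp_atBot.comp hsbot).const_mul 2
    · exact mul_pos two_pos (Real.exp_pos _)
  refine ⟨fun n => 2 * Real.exp (s n), fun n => Complex.arg (Q (2 * Real.exp (s n))), hx, ?_, ?_⟩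
  · have := (Complex.continuousAt_arg hcs).tendsto.comp (hlim.comp hx)
    rwa [Complex.arg_ofReal_of_nonneg hc.le] at this
  · filter_upwards [hroot] with n hn
    simp only [h] at hn
    have hlog : Real.log (2 * Real.exp (s n) / 2) = s n := by
      rw [mul_div_cancel_left₀ _ two_ne_zero, Real.log_exp]
    rw [hlog]
    refine ⟨?_, by linarith⟩
    set z := Q (2 * Real.exp (s n))
    have hz : z * Complex.exp (Complex.I * (γ - β * s n : ℝ))
        = ‖z‖ * Complex.exp (((n : ℕ) * Real.pi : ℝ) * Complex.I) := by
      conv_lhs => rw [← Complex.norm_mul_exp_arg_mul_I z]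
      rw [mul_assoc, ← Complex.exp_add]
      congr 2
      rw [show γ - β * s n = n * Real.pi - Complex.arg z by linarith]
      push_cast
      ring
    rw [hz, Complex.im_ofReal_mul, Complex.exp_ofReal_mul_I_im,
      Real.sin_nat_mul_pi, mul_zero]

/-! ### Gluing two solutions at r₀ -/

section glue

variable {u₁ v₁ w₁ u₂ v₂ w₂ : ℝ → ℝ} {r₀ : ℝ}

theorem hasDerivAt_ite_le (h₁ : ∀ r > 0, HasDerivAt u₁ (v₁ r) r)
    (h₂ : ∀ r > 0, HasDerivAt u₂ (v₂ r) r) (hu : u₁ r₀ = u₂ r₀) (hv : v₁ r₀ = v₂ r₀)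
    {r : ℝ} (hr : 0 < r) :
    HasDerivAt (fun r => if r ≤ r₀ then u₁ r else u₂ r) (if r ≤ r₀ then v₁ r else v₂ r) r := by
  rcases lt_trichotomy r r₀ with h | rfl | h
  · rw [if_pos h.le]
    refine (h₁ r hr).congr_of_eventuallyEq ?_
    filter_upwards [Iio_mem_nhds h] with x hx using if_pos (le_of_lt hx)
  · rw [if_pos le_rfl]
    have hl : HasDerivWithinAt (fun x => if x ≤ r then u₁ x else u₂ x) (v₁ r) (Set.Iic r) r :=
      (h₁ r hr).hasDerivWithinAt.congr (fun x hx => if_pos hx) (if_pos le_rfl)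
    have hg : HasDerivWithinAt (fun x => if x ≤ r then u₁ x else u₂ x) (v₁ r) (Set.Ici r) r := by
      rw [hv]
      refine (h₂ r hr).hasDerivWithinAt.congr (fun x hx => ?_) ((if_pos le_rfl).trans hu)
      rcases (show r ≤ x from hx).eq_or_lt with rfl | hlt
      · exact (if_pos le_rfl).trans hu
      · exact if_neg (not_le.2 hlt)
    have := hl.union hg
    rwa [Set.Iic_union_Ici, hasDerivWithinAt_univ] at this
  · rw [if_neg (not_le.2 h)]
    refine (h₂ r hr).congr_of_eventuallyEq ?_
    filter_upwards [Ioi_mem_nhds h] with x hx using if_neg (not_le.2 hx)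

theorem exists_lipschitzOnWith_Icc (h : ∀ r > 0, HasDerivAt v₁ (w₁ r) r)
    (hw : ContinuousOn w₁ (Set.Ioi 0)) {a b : ℝ} (ha : 0 < a) :
    ∃ K, LipschitzOnWith K v₁ (Set.Icc a b) := by
  have hsub : Set.Icc a b ⊆ Set.Ioi 0 := fun x hx => ha.trans_le hx.1
  obtain ⟨C, hC⟩ := isCompact_Icc.exists_bound_of_continuousOn (hw.mono hsub)
  refine ⟨C.toNNReal, (convex_Icc a b).lipschitzOnWith_of_nnnorm_hasDerivWithin_le
    (fun x hx => (h x (hsub hx)).hasDerivWithinAt) fun x hx => ?_⟩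
  exact NNReal.le_toNNReal_of_coe_le (hC x hx)

theorem absolutelyContinuousOnInterval_ite_le (h₁ : ∀ r > 0, HasDerivAt v₁ (w₁ r) r)
    (hw₁ : ContinuousOn w₁ (Set.Ioi 0)) (h₂ : ∀ r > 0, HasDerivAt v₂ (w₂ r) r)
    (hw₂ : ContinuousOn w₂ (Set.Ioi 0)) (hr₀ : 0 < r₀) (hv : v₁ r₀ = v₂ r₀) {V : ℝ → ℝ}
    (hV : ∀ r > 0, V r = if r ≤ r₀ then v₁ r else v₂ r) {a b : ℝ} (ha : 0 < a) (hab : a ≤ b) :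
    AbsolutelyContinuousOnInterval V a b := by
  have ha' : 0 < min a r₀ := lt_min ha hr₀
  obtain ⟨K₁, hK₁⟩ := exists_lipschitzOnWith_Icc h₁ hw₁ (b := max b r₀) ha'
  obtain ⟨K₂, hK₂⟩ := exists_lipschitzOnWith_Icc h₂ hw₂ (b := max b r₀) ha'
  refine LipschitzOnWith.absolutelyContinuousOnInterval (K := K₁ + K₂) ?_
  rw [Set.uIcc_of_le hab]
  have hsplit : ∀ r > 0, V r = v₁ (min r r₀) + (v₂ (max r r₀) - v₂ r₀) := by
    intro r hr
    rw [hV r hr]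
    split_ifs with h
    · rw [min_eq_left h, max_eq_right h, sub_self, add_zero]
    · rw [min_eq_right (not_le.1 h).le, max_eq_left (not_le.1 h).le, hv]
      ring
  refine LipschitzOnWith.of_dist_le_mul fun x hx y hy => ?_
  have m1 : ∀ z ∈ Set.Icc a b, min z r₀ ∈ Set.Icc (min a r₀) (max b r₀) := fun z hz =>
    ⟨min_le_min_right _ hz.1, (min_le_right _ _).trans (le_max_right _ _)⟩
  have m2 : ∀ z ∈ Set.Icc a b, max z r₀ ∈ Set.Icc (min a r₀) (max b r₀) := fun z hz =>
    ⟨(min_le_right _ _).trans (le_max_right _ _), max_le_max_right _ hz.2⟩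
  have d1 := hK₁.dist_le_mul _ (m1 x hx) _ (m1 y hy)
  have d2 := hK₂.dist_le_mul _ (m2 x hx) _ (m2 y hy)
  have e1 : dist (min x r₀) (min y r₀) ≤ dist x y := by
    simpa [Real.dist_eq] using abs_min_sub_min_le_max x r₀ y r₀
  have e2 : dist (max x r₀) (max y r₀) ≤ dist x y := by
    simpa [Real.dist_eq] using abs_max_sub_max_le_max x r₀ y r₀
  rw [hsplit x (ha.trans_le hx.1), hsplit y (ha.trans_le hy.1)]
  calc dist (v₁ (min x r₀) + (v₂ (max x r₀) - v₂ r₀)) (v₁ (min y r₀) + (v₂ (max y r₀) - v₂ r₀))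
      ≤ dist (v₁ (min x r₀)) (v₁ (min y r₀))
        + dist (v₂ (max x r₀) - v₂ r₀) (v₂ (max y r₀) - v₂ r₀) := dist_add_add_le _ _ _ _
    _ ≤ K₁ * dist x y + K₂ * dist x y := by
        rw [dist_sub_right]
        exact add_le_add (d1.trans (by gcongr)) (d2.trans (by gcongr))
    _ = _ := by push_cast; ring

end glue

/-! ### The inner and outer radial solutions -/

/-- The solution of `u'' = (l(l+1)/r² + q) u` regular at the origin. -/
noncomputable def regularSolution (l : ℕ) (q r : ℝ) : ℝ :=
  r ^ (l + 1) * besselEntire ℝ l (q * r ^ 2)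

/-- The derivative of `regularSolution`. -/
noncomputable def regularSolutionDeriv (l : ℕ) (q r : ℝ) : ℝ :=
  r ^ l * (((l : ℝ) + 1) * besselEntire ℝ l (q * r ^ 2)
    + 2 * (q * r ^ 2) * besselEntireDeriv ℝ l (q * r ^ 2))

theorem hasDerivAt_comp_mul_sq {g g' : ℝ → ℝ} (hg : ∀ w, HasDerivAt g (g' w) w) (q r : ℝ) :
    HasDerivAt (fun r => g (q * r ^ 2)) (g' (q * r ^ 2) * (q * (2 * r))) r := by
  have h1 : HasDerivAt (fun r : ℝ => q * r ^ 2) (q * (2 * r)) r := by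
    simpa using (hasDerivAt_pow 2 r).const_mul q
  exact HasDerivAt.comp r (hg _) h1

theorem hasDerivAt_regularSolution (l : ℕ) (q r : ℝ) :
    HasDerivAt (regularSolution l q) (regularSolutionDeriv l q r) r := by
  have h := (hasDerivAt_pow (l + 1) r).mul
    (hasDerivAt_comp_mul_sq (hasDerivAt_besselEntire (𝕜 := ℝ) l) q r)
  convert! h using 1
  rw [regularSolutionDeriv]
  push_cast
  ring

theorem hasDerivAt_regularSolutionDeriv (l : ℕ) (q : ℝ) {r : ℝ} (hr : 0 < r) :
    HasDerivAt (regularSolutionDeriv l q)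
      (((l : ℝ) * ((l : ℝ) + 1) / r ^ 2 + q) * regularSolution l q r) r := by
  have hG := hasDerivAt_comp_mul_sq (hasDerivAt_besselEntire (𝕜 := ℝ) l) q r
  have hG₁ := hasDerivAt_comp_mul_sq (hasDerivAt_besselEntireDeriv (𝕜 := ℝ) l) q r
  have hq : HasDerivAt (fun r : ℝ => 2 * (q * r ^ 2)) (2 * (q * (2 * r))) r := by
    simpa using ((hasDerivAt_pow 2 r).const_mul q).const_mul 2
  have h := (hasDerivAt_pow l r).mul ((hG.const_mul ((l : ℝ) + 1)).add (hq.mul hG₁))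
  convert! h using 1
  -- For l = 0 the truncated exponent l - 1 is harmless, as the factor l vanishes.
  have hpow : (l : ℝ) * r ^ (l - 1) = l * r ^ l / r := by
    rcases l with _ | l
    · simp
    · rw [Nat.add_sub_cancel, pow_succ]
      field_simp
  have hode := besselEntire_ode l (q * r ^ 2)
  simp only [Pi.mul_apply, Pi.add_apply]
  rw [hpow, regularSolution, pow_succ r l]
  revert hode
  generalize besselEntire ℝ l (q * r ^ 2) = G
  generalize besselEntireDeriv ℝ l (q * r ^ 2) = G₁
  generalize besselEntireDeriv₂ ℝ l (q * r ^ 2) = G₂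
  intro hode
  field_simp
  linear_combination (-4 * q * r ^ 2) * hode

/-- The solution of `u'' = (κ² - (β² + 1/4)/r²) u` decaying at infinity. -/
noncomputable def decayingSolution (β κ r : ℝ) : ℝ :=
  Real.sqrt r * (macdonaldH β (κ * r)).im

/-- The derivative of `decayingSolution`. -/
noncomputable def decayingSolutionDeriv (β κ r : ℝ) : ℝ :=
  ((macdonaldH β (κ * r)).im / 2 - β * (macdonaldH β (κ * r)).re) / Real.sqrt r

section decaying

variable {β κ : ℝ}

theorem hasDerivAt_macdonaldH_im_comp (hβ : β ≠ 0) (hκ : 0 < κ) {r : ℝ} (hr : 0 < r) :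
    HasDerivAt (fun r => (macdonaldH β (κ * r)).im) (-β / r * (macdonaldH β (κ * r)).re) r := by
  have h := HasDerivAt.comp (h := fun r => κ * r) r
    (hasDerivAt_macdonaldH_im hβ (mul_pos hκ hr)) ((hasDerivAt_id r).const_mul κ)
  convert! h using 1
  field_simp

theorem hasDerivAt_macdonaldH_re_comp (hβ : β ≠ 0) (hκ : 0 < κ) {r : ℝ} (hr : 0 < r) :
    HasDerivAt (fun r => (macdonaldH β (κ * r)).re)
      ((β / r - κ ^ 2 * r / β) * (macdonaldH β (κ * r)).im) r := by
  have h := HasDerivAt.comp (h := fun r => κ * r) r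
    (hasDerivAt_macdonaldH_re hβ (mul_pos hκ hr)) ((hasDerivAt_id r).const_mul κ)
  convert! h using 1
  field_simp

theorem hasDerivAt_decayingSolution (hβ : β ≠ 0) (hκ : 0 < κ) {r : ℝ} (hr : 0 < r) :
    HasDerivAt (decayingSolution β κ) (decayingSolutionDeriv β κ r) r := by
  have h := (Real.hasDerivAt_sqrt hr.ne').mul (hasDerivAt_macdonaldH_im_comp hβ hκ hr)
  convert! h using 1
  have hs : 0 < Real.sqrt r := Real.sqrt_pos.2 hr
  have hs2 : Real.sqrt r ^ 2 = r := Real.sq_sqrt hr.le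
  rw [decayingSolutionDeriv]
  rw [show -β / r = -β / Real.sqrt r ^ 2 by rw [hs2]]
  field_simp
  ring

theorem hasDerivAt_decayingSolutionDeriv (hβ : β ≠ 0) (hκ : 0 < κ) {r : ℝ} (hr : 0 < r) :
    HasDerivAt (decayingSolutionDeriv β κ)
      ((κ ^ 2 - (β ^ 2 + 1 / 4) / r ^ 2) * decayingSolution β κ r) r := by
  have hs : 0 < Real.sqrt r := Real.sqrt_pos.2 hr
  have h := (((hasDerivAt_macdonaldH_im_comp hβ hκ hr).div_const 2).sub
    ((hasDerivAt_macdonaldH_re_comp hβ hκ hr).const_mul β)).div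
    (Real.hasDerivAt_sqrt hr.ne') hs.ne'
  convert! h using 1
  have hs2 : Real.sqrt r ^ 2 = r := Real.sq_sqrt hr.le
  rw [decayingSolution]
  simp only [Pi.sub_apply]
  set s := Real.sqrt r
  rw [← hs2]
  field_simp
  ring

/-- The factor r costs half of the decay e^{-κr}, through r ≤ (2/κ) e^{κr/2}. -/
theorem decayingSolution_sq_le (hκ : 0 < κ) {r : ℝ} (hr : 0 < r) :
    decayingSolution β κ r ^ 2 ≤ 8 / κ * Real.exp (-(κ / 2) * r) := by
  have h1 : |(macdonaldH β (κ * r)).im| ≤ 2 * Real.exp (-(κ * r / 2)) :=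
    (Complex.abs_im_le_norm _).trans (norm_macdonaldH_le β _)
  have h2 : (macdonaldH β (κ * r)).im ^ 2 ≤ (2 * Real.exp (-(κ * r / 2))) ^ 2 :=
    sq_le_sq' (abs_le.1 h1).1 (abs_le.1 h1).2
  have h3 : r ≤ 2 / κ * Real.exp (κ / 2 * r) := by
    have := Real.add_one_le_exp (κ / 2 * r)
    rw [div_mul_eq_mul_div, le_div_iff₀ hκ]
    linarith
  rw [decayingSolution, mul_pow, Real.sq_sqrt hr.le]
  calc r * (macdonaldH β (κ * r)).im ^ 2
      ≤ 2 / κ * Real.exp (κ / 2 * r) * (2 * Real.exp (-(κ * r / 2))) ^ 2 := by gcongr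
    _ = 8 / κ * (Real.exp (κ / 2 * r) * (Real.exp (-(κ * r / 2)) * Real.exp (-(κ * r / 2)))) := by
        ring
    _ = _ := by
        rw [← Real.exp_add, ← Real.exp_add]
        congr 2
        ring

end decaying

/-! ### Eigenvalues from matching -/

/-- Equal values and slopes at r₀ make the glued function C¹ with locally Lipschitz derivative.
Dividing by G(0) > 0 produces the normalization at the origin. -/
theorem isRadialEigenvalue_of_match {ε r₀ Λ κ β c : ℝ} {l : ℕ} (hε : 0 < ε) (hr₀ : 0 < r₀)
    (hκ : 0 < κ) (hβ : β ≠ 0)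
    (hβ2 : β ^ 2 = -((l : ℝ) * ((l : ℝ) + 1)) + lambertW 1 ^ 2 / ε ^ 2 - 1 / 4)
    (h0 : regularSolution l (Λ / ε ^ 2 + κ ^ 2) r₀ = c * decayingSolution β κ r₀)
    (h1 : regularSolutionDeriv l (Λ / ε ^ 2 + κ ^ 2) r₀ = c * decayingSolutionDeriv β κ r₀) :
    IsRadialEigenvalue ε l (auxPotential Λ r₀) (-ε ^ 2 * κ ^ 2) := by
  set q := Λ / ε ^ 2 + κ ^ 2 with hq
  have hG0 := besselEntire_zero_pos l
  set g := besselEntire ℝ l 0 with hg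
  let u₁ : ℝ → ℝ := fun r => regularSolution l q r / g
  let v₁ : ℝ → ℝ := fun r => regularSolutionDeriv l q r / g
  let w₁ : ℝ → ℝ := fun r => ((l : ℝ) * ((l : ℝ) + 1) / r ^ 2 + q) * regularSolution l q r / g
  let u₂ : ℝ → ℝ := fun r => c / g * decayingSolution β κ r
  let v₂ : ℝ → ℝ := fun r => c / g * decayingSolutionDeriv β κ r
  let w₂ : ℝ → ℝ := fun r => c / g * ((κ ^ 2 - (β ^ 2 + 1 / 4) / r ^ 2) * decayingSolution β κ r)
  have d1 : ∀ r > 0, HasDerivAt u₁ (v₁ r) r :=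
    fun r _ => (hasDerivAt_regularSolution l q r).div_const g
  have d1' : ∀ r > 0, HasDerivAt v₁ (w₁ r) r :=
    fun r hr => (hasDerivAt_regularSolutionDeriv l q hr).div_const g
  have d2 : ∀ r > 0, HasDerivAt u₂ (v₂ r) r :=
    fun r hr => (hasDerivAt_decayingSolution hβ hκ hr).const_mul (c / g)
  have d2' : ∀ r > 0, HasDerivAt v₂ (w₂ r) r :=
    fun r hr => (hasDerivAt_decayingSolutionDeriv hβ hκ hr).const_mul (c / g)
  have hu₁c : Continuous (regularSolution l q) := continuous_iff_continuousAt.2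
    fun r => (hasDerivAt_regularSolution l q r).continuousAt
  have hu₂c : ContinuousOn (decayingSolution β κ) (Set.Ioi 0) :=
    fun r hr => (hasDerivAt_decayingSolution hβ hκ hr).continuousAt.continuousWithinAt
  have hne : ∀ r ∈ Set.Ioi (0 : ℝ), r ^ 2 ≠ 0 := fun r hr => pow_ne_zero 2 (ne_of_gt hr)
  have hw₁ : ContinuousOn w₁ (Set.Ioi 0) :=
    (((continuousOn_const.div (by fun_prop) hne).add continuousOn_const).mul
      hu₁c.continuousOn).div_const g
  have hw₂ : ContinuousOn w₂ (Set.Ioi 0) :=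
    continuousOn_const.mul
      ((continuousOn_const.sub (continuousOn_const.div (by fun_prop) hne)).mul hu₂c)
  have hu : u₁ r₀ = u₂ r₀ := by simp only [u₁, u₂, h0]; ring
  have hv : v₁ r₀ = v₂ r₀ := by simp only [v₁, v₂, h1]; ring
  let u : ℝ → ℝ := fun r => if r ≤ r₀ then u₁ r else u₂ r
  have du : ∀ r > 0, HasDerivAt u (if r ≤ r₀ then v₁ r else v₂ r) r :=
    fun r hr => hasDerivAt_ite_le d1 d2 hu hv hr
  have hu_near : u =ᶠ[𝓝[>] 0] u₁ := by
    filter_upwards [Ioo_mem_nhdsGT hr₀] with r hr using if_pos hr.2.le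
  have hucont : ContinuousOn u (Set.Ioi 0) :=
    fun r hr => (du r hr).continuousAt.continuousWithinAt
  refine ⟨u, ⟨fun r hr => (du r hr).differentiableAt.differentiableWithinAt, ?_, ?_, ?_, ?_, ?_⟩⟩
  · intro a b ha hab
    exact absolutelyContinuousOnInterval_ite_le d1' hw₁ d2' hw₂ hr₀ hv
      (fun r hr => (du r hr).deriv) ha hab
  -- The second derivative may jump at r₀, a null set.
  · have hr₀ae : ∀ᵐ r ∂(volume.restrict (Set.Ioi (0 : ℝ))), r ≠ r₀ :=
      ae_restrict_of_ae (by simp [ae_iff])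
    filter_upwards [hr₀ae, self_mem_ae_restrict measurableSet_Ioi] with r hne hr
    have hr' : (0 : ℝ) < r := hr
    have hderiv : deriv u =ᶠ[𝓝 r] fun r => if r ≤ r₀ then v₁ r else v₂ r := by
      filter_upwards [Ioi_mem_nhds hr'] with x hx using (du x hx).deriv
    rw [hderiv.deriv_eq]
    rcases lt_or_gt_of_ne hne with h | h
    · have : (fun r => if r ≤ r₀ then v₁ r else v₂ r) =ᶠ[𝓝 r] v₁ := by
        filter_upwards [Iio_mem_nhds h] with x hx using if_pos (le_of_lt hx)
      rw [this.deriv_eq, (d1' r hr').deriv, auxPotential, if_pos h.le]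
      simp only [u, if_pos h.le, u₁, w₁, hq]
      field_simp
      ring
    · have hn : ¬ r ≤ r₀ := not_le.2 h
      have : (fun r => if r ≤ r₀ then v₁ r else v₂ r) =ᶠ[𝓝 r] v₂ := by
        filter_upwards [Ioi_mem_nhds h] with x hx using if_neg (not_le.2 hx)
      rw [this.deriv_eq, (d2' r hr').deriv, auxPotential, if_neg hn]
      simp only [u, if_neg hn, u₂, w₂]
      rw [hβ2]
      field_simp
      ring
  · rw [memLp_two_iff_integrable_sq (hucont.aestronglyMeasurable measurableSet_Ioi)]
    have hsplit : Set.Ioi (0 : ℝ) = Set.Ioc 0 r₀ ∪ Set.Ioi r₀ :=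
      (Set.Ioc_union_Ioi_eq_Ioi hr₀.le).symm
    change IntegrableOn (fun r => u r ^ 2) (Set.Ioi 0)
    rw [hsplit]
    refine IntegrableOn.union ?_ ?_
    · have : IntegrableOn (fun r => u₁ r ^ 2) (Set.Ioc 0 r₀) :=
        (((hu₁c.div_const g).pow 2).continuousOn.integrableOn_Icc).mono_set
          Set.Ioc_subset_Icc_self
      refine this.congr_fun (fun r hr => ?_) measurableSet_Ioc
      simp only [u, if_pos hr.2]
    · have hi : IntegrableOn (fun r : ℝ => (c / g) ^ 2 * (8 / κ * Real.exp (-(κ / 2) * r)))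
          (Set.Ioi r₀) :=
        ((integrableOn_exp_mul_Ioi (a := -(κ / 2)) (by linarith) r₀).const_mul _).const_mul _
      have hsub : Set.Ioi r₀ ⊆ Set.Ioi 0 := Set.Ioi_subset_Ioi hr₀.le
      refine Integrable.mono' hi
        (((hucont.mono hsub).pow 2).aestronglyMeasurable measurableSet_Ioi) ?_
      filter_upwards [self_mem_ae_restrict measurableSet_Ioi] with r hr
      rw [Real.norm_of_nonneg (sq_nonneg _)]
      simp only [u, if_neg (not_le.2 (show r₀ < r from hr)), u₂]
      rw [mul_pow]
      exact mul_le_mul_of_nonneg_left (decayingSolution_sq_le hκ (hr₀.trans hr)) (sq_nonneg _)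
  · refine Tendsto.congr' hu_near.symm ?_
    have := (hu₁c.div_const g).tendsto 0
    simp only [regularSolution, zero_pow (Nat.succ_ne_zero l), zero_mul, zero_div] at this
    exact this.mono_left nhdsWithin_le_nhds
  · have hlim : Tendsto (fun r : ℝ => besselEntire ℝ l (q * r ^ 2) / g) (𝓝[>] 0) (𝓝 1) := by
      have hc : Continuous fun r : ℝ => besselEntire ℝ l (q * r ^ 2) / g :=
        ((continuous_besselEntire (𝕜 := ℝ) l).comp (by fun_prop)).div_const g
      have := hc.tendsto 0
      rw [zero_pow two_ne_zero, mul_zero, ← hg, div_self hG0.ne'] at this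
      exact this.mono_left nhdsWithin_le_nhds
    refine hlim.congr' ?_
    filter_upwards [hu_near, self_mem_nhdsWithin] with r hr hr0
    have : r ^ (l + 1) ≠ 0 := pow_ne_zero _ (ne_of_gt hr0)
    rw [hr]
    simp only [u₁, regularSolution]
    field_simp

/-! ### Matching as a phase condition -/

/-- `w ↦ 2^ν w^{-ν/2} √w I_ν'(√w)` for `ν = l + 1/2`. -/
noncomputable def besselEuler (l : ℕ) (w : ℝ) : ℝ :=
  ((l : ℝ) + 1 / 2) * besselEntire ℝ l w + 2 * w * besselEntireDeriv ℝ l w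

theorem continuous_besselEuler (l : ℕ) : Continuous (besselEuler l) := by
  have h := continuous_besselEntire (𝕜 := ℝ) l
  have h₁ := continuous_besselEntireDeriv (𝕜 := ℝ) l
  unfold besselEuler
  fun_prop

theorem ofReal_besselEuler (l : ℕ) (w : ℝ) :
    ((l : ℂ) + 1 / 2) * besselEntire ℂ l (w : ℂ) + 2 * (w : ℂ) * besselEntireDeriv ℂ l (w : ℂ)
      = (besselEuler l w : ℂ) := by
  rw [besselEuler, besselEntire, besselEntireDeriv, scalarSeries_ofReal, scalarSeries_ofReal]
  push_cast
  rfl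

theorem deriv_besselIHalf_eq_zero_iff (l : ℕ) {z : ℂ} {w : ℝ} (hz : z ∈ Complex.slitPlane)
    (hw : z ^ 2 = w) : deriv (besselIHalf l) z = 0 ↔ besselEuler l w = 0 := by
  have hz0 : z ≠ 0 := Complex.slitPlane_ne_zero hz
  rw [(hasDerivAt_besselIHalf l hz).deriv, hw, ofReal_besselEuler]
  simp [half_cpow_ne_zero l hz0, hz0, -one_div]

theorem efimovF_eq_ofReal (l : ℕ) {z : ℂ} {w : ℝ} (hz : z ∈ Complex.slitPlane)
    (hw : z ^ 2 = w) :
    efimovF l z = ((besselEntire ℝ l w / (2 * besselEuler l w) : ℝ) : ℂ) := by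
  rw [efimovF_eq l hz, hw, ofReal_besselEuler, besselEntire, scalarSeries_ofReal]
  push_cast
  rfl

/-- If `b Im h + a β Re h = 0` and `h ≠ 0`, then `(a, b)` is a multiple of `(Im h, -β Re h)`. -/
theorem exists_proportional {a b β : ℝ} {h : ℂ} (hβ : β ≠ 0) (hh : h ≠ 0)
    (hab : b * h.im + a * β * h.re = 0) : ∃ c, a = c * h.im ∧ b = -c * β * h.re := by
  have hpos : h.im ^ 2 + β ^ 2 * h.re ^ 2 ≠ 0 := by
    intro h0
    have h1 : h.im = 0 := by nlinarith [sq_nonneg h.im, mul_nonneg (sq_nonneg β) (sq_nonneg h.re)]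
    have h2 : β ^ 2 * h.re ^ 2 = 0 := by rw [h1] at h0; linarith
    have h3 : h.re = 0 := by simpa [hβ] using h2
    exact hh (Complex.ext h3 h1)
  refine ⟨(a * h.im - b * β * h.re) / (h.im ^ 2 + β ^ 2 * h.re ^ 2), ?_, ?_⟩
  · rw [div_mul_eq_mul_div, eq_div_iff hpos]
    linear_combination β * h.re * hab
  · rw [← neg_div, div_mul_eq_mul_div, div_mul_eq_mul_div, eq_div_iff hpos]
    linear_combination h.im * hab

/-- The factor ρ may be negative: only the phase modulo π matters, so an arctangent can replace the
argument. -/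
theorem exists_polar_arctan {a b β : ℝ} (hβ : β ≠ 0) (hab : b = 0 → a ≠ 0) :
    ∃ ρ : ℝ, ρ ≠ 0 ∧ (b + Complex.I * (β * a) : ℂ)
      = ρ * Complex.exp (Complex.I *
        ((if b = 0 then Real.pi / 2 else Real.arctan (β * a / b) : ℝ) : ℂ)) := by
  split_ifs with hb
  · refine ⟨β * a, mul_ne_zero hβ (hab hb), ?_⟩
    rw [hb, mul_comm Complex.I ((Real.pi / 2 : ℝ) : ℂ)]
    push_cast
    rw [Complex.exp_pi_div_two_mul_I]
    ring
  · set θ := Real.arctan (β * a / b) with hθ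
    have hcos : Real.cos θ ≠ 0 := (Real.cos_arctan_pos _).ne'
    have hsin : b * Real.sin θ = β * a * Real.cos θ := by
      have h := Real.tan_arctan (β * a / b)
      rw [← hθ, Real.tan_eq_sin_div_cos, div_eq_div_iff hcos hb] at h
      linarith
    refine ⟨b / Real.cos θ, div_ne_zero hb hcos, ?_⟩
    rw [mul_comm Complex.I (θ : ℂ)]
    apply Complex.ext
    · rw [Complex.re_ofReal_mul, Complex.exp_ofReal_mul_I_re]
      simp
      field_simp
    · rw [Complex.im_ofReal_mul, Complex.exp_ofReal_mul_I_im]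
      simp
      field_simp
      linarith

/-- Up to a common shift by 1/2, the quantities r u'/u at r₀ are b/G inside and -β Re H / Im H
outside. The vanishing imaginary part is their equality cleared of denominators, so zeros of G or Im
H need no separate treatment. -/
theorem isRadialEigenvalue_of_phase {ε r₀ Λ β x : ℝ} {l : ℕ} (hε : 0 < ε) (hr₀ : 0 < r₀)
    (hβ : β ≠ 0) (hβ2 : β ^ 2 = -((l : ℝ) * ((l : ℝ) + 1)) + lambertW 1 ^ 2 / ε ^ 2 - 1 / 4)
    (hx : 0 < x) (hH : macdonaldH β x ≠ 0)
    (him : ((besselEuler l (Λ / ε ^ 2 * r₀ ^ 2 + x ^ 2)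
      + Complex.I * (β * besselEntire ℝ l (Λ / ε ^ 2 * r₀ ^ 2 + x ^ 2))) * macdonaldH β x).im = 0) :
    IsRadialEigenvalue ε l (auxPotential Λ r₀) (-ε ^ 2 * (x / r₀) ^ 2) := by
  have hw : (Λ / ε ^ 2 + (x / r₀) ^ 2) * r₀ ^ 2 = Λ / ε ^ 2 * r₀ ^ 2 + x ^ 2 := by
    field_simp
  have hxr : x / r₀ * r₀ = x := by field_simp
  set w := Λ / ε ^ 2 * r₀ ^ 2 + x ^ 2
  obtain ⟨c, hc1, hc2⟩ := exists_proportional (a := besselEntire ℝ l w) (b := besselEuler l w)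
    hβ hH (by
      simp [Complex.mul_im, add_comm] at him
      linarith)
  have hs : 0 < Real.sqrt r₀ := Real.sqrt_pos.2 hr₀
  have hs2 : Real.sqrt r₀ ^ 2 = r₀ := Real.sq_sqrt hr₀.le
  refine isRadialEigenvalue_of_match (c := c * r₀ ^ (l + 1) / Real.sqrt r₀) hε hr₀
    (div_pos hx hr₀) hβ hβ2 ?_ ?_
  · rw [regularSolution, decayingSolution, hw, hxr, hc1]
    field_simp
  · rw [regularSolutionDeriv, decayingSolutionDeriv, hw, hxr]
    have : ((l : ℝ) + 1) * besselEntire ℝ l w + 2 * w * besselEntireDeriv ℝ l w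
        = besselEuler l w + besselEntire ℝ l w / 2 := by
      rw [besselEuler]
      ring
    rw [this, hc1, hc2, pow_succ]
    nth_rw 3 [← hs2]
    field_simp
    ring

/-! ### The sequence of eigenvalues -/

theorem exists_eigenvalue_sequence {ε r₀ Λ β α ρ : ℝ} {l : ℕ} (hε : 0 < ε) (hr₀ : 0 < r₀)
    (hβ : 0 < β) (hβ2 : β ^ 2 = -((l : ℝ) * ((l : ℝ) + 1)) + lambertW 1 ^ 2 / ε ^ 2 - 1 / 4)
    (hρ : ρ ≠ 0)
    (hα : (besselEuler l (Λ / ε ^ 2 * r₀ ^ 2)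
      + Complex.I * (β * besselEntire ℝ l (Λ / ε ^ 2 * r₀ ^ 2)) : ℂ)
      = ρ * Complex.exp (Complex.I * α)) :
    ∃ E ζ : ℕ → ℝ,
      (∀ n, E n < 0 ∧ IsRadialEigenvalue ε l (auxPotential Λ r₀) (E n)) ∧
      Tendsto E atTop (𝓝 0) ∧ Tendsto ζ atTop (𝓝 0) ∧
      ∀ n : ℕ, E n = -ε ^ 2 * (4 / r₀ ^ 2) *
        Real.exp (2 / β * (α + efimovPhi β - (n : ℝ) * Real.pi)) * (1 + ζ n) := by
  set w₀ := Λ / ε ^ 2 * r₀ ^ 2 with hw₀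
  set φ := efimovPhi β with hφ
  set Γ₁ := Complex.Gamma (1 + Complex.I * β) with hΓ
  have hΓ0 : Γ₁ ≠ 0 := Complex.Gamma_ne_zero_of_re_pos (by simp)
  have hρc : (ρ : ℂ) ≠ 0 := by exact_mod_cast hρ
  let D : ℝ → ℂ := fun x => (besselEuler l (w₀ + x ^ 2) : ℂ)
    + Complex.I * (β * besselEntire ℝ l (w₀ + x ^ 2))
  -- The limiting phases α and φ are divided out, so that Q tends to the positive number |Γ(1+iβ)|.
  let Q : ℝ → ℂ := fun x => (ρ : ℂ)⁻¹ * Complex.exp (-(Complex.I * α))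
    * Complex.exp (-(Complex.I * φ)) * D x * macdonaldIntegral β 0 (x ^ 2 / 4)
  have hD : Continuous D := by
    have h1 : Continuous fun x : ℝ => besselEuler l (w₀ + x ^ 2) :=
      (continuous_besselEuler l).comp (by fun_prop)
    have h2 : Continuous fun x : ℝ => besselEntire ℝ l (w₀ + x ^ 2) :=
      (continuous_besselEntire (𝕜 := ℝ) l).comp (by fun_prop)
    fun_prop
  have hA : ContinuousOn (fun x : ℝ => macdonaldIntegral β 0 (x ^ 2 / 4)) (Set.Ioi 0) :=
    (continuousOn_macdonaldIntegral β 0).comp (by fun_prop) fun x hx => by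
      have : (0 : ℝ) < x := hx
      exact Set.mem_Ioi.2 (by positivity)
  have hAlim : Tendsto (fun x : ℝ => macdonaldIntegral β 0 (x ^ 2 / 4)) (𝓝[>] 0) (𝓝 Γ₁) := by
    refine (tendsto_macdonaldIntegral_zero β).comp (tendsto_nhdsWithin_iff.2 ⟨?_, ?_⟩)
    · have : Tendsto (fun x : ℝ => x ^ 2 / 4) (𝓝 0) (𝓝 (0 ^ 2 / 4)) :=
        Continuous.tendsto (by fun_prop) 0
      norm_num at this
      exact this.mono_left nhdsWithin_le_nhds
    · filter_upwards [self_mem_nhdsWithin] with x hx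
      have : (0 : ℝ) < x := hx
      exact Set.mem_Ioi.2 (by positivity)
  have hQ : ContinuousOn Q (Set.Ioi 0) :=
    (continuousOn_const.mul hD.continuousOn).mul hA
  have hQlim : Tendsto Q (𝓝[>] 0) (𝓝 ((‖Γ₁‖ : ℝ) : ℂ)) := by
    have h := ((hD.tendsto 0).mono_left nhdsWithin_le_nhds).const_mul
      ((ρ : ℂ)⁻¹ * Complex.exp (-(Complex.I * α)) * Complex.exp (-(Complex.I * φ))) |>.mul hAlim
    have hval : (ρ : ℂ)⁻¹ * Complex.exp (-(Complex.I * α)) * Complex.exp (-(Complex.I * φ))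
        * D 0 * Γ₁ = ((‖Γ₁‖ : ℝ) : ℂ) := by
      have hD0 : D 0 = ρ * Complex.exp (Complex.I * α) := by
        rw [← hα]
        simp only [D, zero_pow two_ne_zero, add_zero]
      have hΓpol : Γ₁ = ‖Γ₁‖ * Complex.exp (Complex.I * φ) := by
        conv_lhs => rw [← Complex.norm_mul_exp_arg_mul_I Γ₁]
        rw [mul_comm (Complex.arg Γ₁ : ℂ)]
        rfl
      rw [hD0]
      conv_lhs => rw [hΓpol]
      rw [Complex.exp_neg, Complex.exp_neg]
      have e1 := Complex.exp_ne_zero (Complex.I * α)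
      have e2 := Complex.exp_ne_zero (Complex.I * φ)
      field_simp
    rw [hval] at h
    exact h
  obtain ⟨x, δ, hx, hδ, hev⟩ := exists_phase_sequence (γ := α + φ) hβ (norm_pos_iff.2 hΓ0) hQ hQlim
  have hgood : ∀ᶠ n : ℕ in atTop,
      IsRadialEigenvalue ε l (auxPotential Λ r₀) (-ε ^ 2 * (x n / r₀) ^ 2) ∧ 0 < x n ∧
        β * Real.log (x n / 2) = α + φ - n * Real.pi + δ n := by
    filter_upwards [hev, hx.eventually self_mem_nhdsWithin,
      (hAlim.comp hx).eventually_ne hΓ0] with n ⟨hn, hlog⟩ hxn hAn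
    have hxn' : 0 < x n := hxn
    refine ⟨isRadialEigenvalue_of_phase hε hr₀ hβ.ne' hβ2 hxn' ?_ ?_, hxn', hlog⟩
    · exact mul_ne_zero (Complex.exp_ne_zero _) hAn
    · have heq : Q (x n) * Complex.exp (Complex.I * (α + φ - β * Real.log (x n / 2) : ℝ))
          = ((ρ⁻¹ : ℝ) : ℂ) * (D (x n) * macdonaldH β (x n)) := by
        have hexp : Complex.exp (-(Complex.I * α)) * Complex.exp (-(Complex.I * φ))
            * Complex.exp (Complex.I * (α + φ - β * Real.log (x n / 2) : ℝ))
            = Complex.exp (-(Complex.I * β * Real.log (x n / 2))) := by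
          rw [← Complex.exp_add, ← Complex.exp_add]
          congr 1
          push_cast
          ring
        rw [macdonaldH, ← hexp]
        simp only [Q]
        push_cast
        ring
      rw [heq, Complex.im_ofReal_mul] at hn
      exact (mul_eq_zero.1 hn).resolve_left (inv_ne_zero hρ)
  obtain ⟨N, hN⟩ := eventually_atTop.1 hgood
  -- Roots are only guaranteed from N on; earlier indices repeat the N-th one, which the freedom in
  -- ζ allows.
  let E : ℕ → ℝ := fun n => -ε ^ 2 * (x (max n N) / r₀) ^ 2
  let f : ℕ → ℝ := fun n =>
    -ε ^ 2 * (4 / r₀ ^ 2) * Real.exp (2 / β * (α + φ - (n : ℝ) * Real.pi))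
  have hf : ∀ n, f n ≠ 0 := by
    intro n
    have : 0 < ε ^ 2 * (4 / r₀ ^ 2) * Real.exp (2 / β * (α + φ - (n : ℝ) * Real.pi)) := by
      positivity
    simp only [f, neg_mul]
    exact neg_ne_zero.2 this.ne'
  -- With ζ defined as the relative error the formula holds for every n; for n ≥ N it equals
  -- e^{2δ_n/β} - 1.
  refine ⟨E, fun n => E n / f n - 1, fun n => ?_, ?_, ?_, fun n => ?_⟩
  · obtain ⟨h1, h2, -⟩ := hN (max n N) (le_max_right _ _)
    refine ⟨?_, h1⟩
    have : 0 < ε ^ 2 * (x (max n N) / r₀) ^ 2 := by positivity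
    simp only [E]
    linarith
  · have hx0 : Tendsto x atTop (𝓝 0) := hx.mono_right nhdsWithin_le_nhds
    have h1 : Tendsto (fun n => -ε ^ 2 * (x n / r₀) ^ 2) atTop (𝓝 (-ε ^ 2 * (0 / r₀) ^ 2)) :=
      ((hx0.div_const r₀).pow 2).const_mul _
    simp only [zero_div, zero_pow two_ne_zero, mul_zero] at h1
    refine h1.congr' ?_
    filter_upwards [eventually_ge_atTop N] with n hn
    simp only [E, max_eq_left hn]
  · have h1 : Tendsto (fun n => Real.exp (2 / β * δ n) - 1) atTop (𝓝 0) := by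
      have := ((Real.continuous_exp.tendsto _).comp (hδ.const_mul (2 / β))).sub_const 1
      simpa using this
    refine h1.congr' ?_
    filter_upwards [eventually_ge_atTop N] with n hn
    obtain ⟨-, h2, h3⟩ := hN n hn
    congr 1
    rw [eq_div_iff (hf n)]
    simp only [E, f, max_eq_left hn]
    have hexp : Real.exp (2 / β * δ n) * Real.exp (2 / β * (α + φ - (n : ℝ) * Real.pi))
        = (x n / 2) ^ 2 := by
      rw [← Real.exp_add, ← mul_add, add_comm (δ n), ← h3]
      have : 2 / β * (β * Real.log (x n / 2)) = Real.log ((x n / 2) ^ 2) := by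
        rw [Real.log_pow]
        push_cast
        field_simp
      rw [this, Real.exp_log (by positivity)]
    calc Real.exp (2 / β * δ n) * (-ε ^ 2 * (4 / r₀ ^ 2)
          * Real.exp (2 / β * (α + φ - (n : ℝ) * Real.pi)))
        = -ε ^ 2 * (4 / r₀ ^ 2) * (Real.exp (2 / β * δ n)
          * Real.exp (2 / β * (α + φ - (n : ℝ) * Real.pi))) := by ring
      _ = -ε ^ 2 * (x n / r₀) ^ 2 := by
        rw [hexp]
        field_simp
        ring
  · change E n = f n * (1 + (E n / f n - 1))
    have := hf n
    field_simp
    ring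

/-! ### The main theorem -/

theorem efimovXi_sq {ε Λ r₀ : ℝ} :
    efimovXi ε Λ r₀ ^ 2 = ((Λ / ε ^ 2 * r₀ ^ 2 : ℝ) : ℂ) := by
  rw [efimovXi, mul_pow, Complex.sqrt, Complex.cpow_ofNat_inv_pow]
  push_cast
  rfl

theorem mem_slitPlane_of_sq_neg {z : ℂ} {w : ℝ} (hw : w < 0) (hz : z ^ 2 = w) :
    z ∈ Complex.slitPlane := by
  refine Complex.mem_slitPlane_iff.2 (Or.inr fun him => ?_)
  have h := congrArg Complex.re hz
  rw [pow_two, Complex.mul_re, him, Complex.ofReal_re] at h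
  nlinarith [mul_self_nonneg z.re]

theorem mainTheorem3 (l : ℕ) (ε r₀ Λ : ℝ) (hε : 0 < ε) (hr₀ : 0 < r₀) (hΛ : Λ ≤ 0)
    (hβ : 0 < -((l : ℝ) * ((l : ℝ) + 1)) + lambertW 1 ^ 2 / ε ^ 2 - 1 / 4) :
    Tendsto (efimovF l) (𝓝[Complex.slitPlane] 0) (𝓝 (1 / (2 * (l : ℂ) + 1))) ∧
    ∃ α : ℝ,
      -- `α` is `arctan (2 β f(ξ₀))`, where `f(0)` is the limit `1 / (2 l + 1)`, and where
      -- `arctan ∞ = π / 2` at a pole of `f`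
      (Λ = 0 → α = Real.arctan (2 * efimovBeta ε l * (1 / (2 * (l : ℝ) + 1)))) ∧
      (Λ < 0 → deriv (besselIHalf l) (efimovXi ε Λ r₀) ≠ 0 →
        ∃ F : ℝ, efimovF l (efimovXi ε Λ r₀) = (F : ℂ) ∧
          α = Real.arctan (2 * efimovBeta ε l * F)) ∧
      (Λ < 0 → deriv (besselIHalf l) (efimovXi ε Λ r₀) = 0 → α = Real.pi / 2) ∧
      ∃ E ζ : ℕ → ℝ,
        (∀ n, E n < 0 ∧ IsRadialEigenvalue ε l (auxPotential Λ r₀) (E n)) ∧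
        Tendsto E atTop (𝓝 0) ∧
        Tendsto ζ atTop (𝓝 0) ∧
        ∀ n : ℕ, E n = -ε ^ 2 * (4 / r₀ ^ 2) *
          Real.exp (2 / efimovBeta ε l *
            (α + efimovPhi (efimovBeta ε l) - (n : ℝ) * Real.pi)) * (1 + ζ n) := by
  refine ⟨tendsto_efimovF l, ?_⟩
  have hβpos : 0 < efimovBeta ε l := Real.sqrt_pos.2 hβ
  have hβ2 : efimovBeta ε l ^ 2 = _ := Real.sq_sqrt hβ.le
  set β := efimovBeta ε l
  set w₀ : ℝ := Λ / ε ^ 2 * r₀ ^ 2 with hw₀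
  have hw₀le : w₀ ≤ 0 :=
    mul_nonpos_of_nonpos_of_nonneg (div_nonpos_of_nonpos_of_nonneg hΛ (by positivity))
      (by positivity)
  -- If b and G both vanished at w₀, so would w₀ G'(w₀), which Λ ≤ 0 excludes.
  have hne : besselEuler l w₀ = 0 → besselEntire ℝ l w₀ ≠ 0 := by
    intro hb ha
    refine besselEntire_no_common_zero l hw₀le ha ?_
    rw [besselEuler, ha] at hb
    linarith
  obtain ⟨ρ, hρ, hpol⟩ := exists_polar_arctan hβpos.ne' hne
  have hslit : Λ < 0 → efimovXi ε Λ r₀ ∈ Complex.slitPlane := fun h =>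
    mem_slitPlane_of_sq_neg
      (mul_neg_of_neg_of_pos (div_neg_of_neg_of_pos h (by positivity)) (by positivity)) efimovXi_sq
  -- The witness α is read off from `hpol`: π/2 if b(w₀) = 0, and otherwise arctan(βG(w₀)/b(w₀)).
  refine ⟨_, ?_, ?_, ?_, exists_eigenvalue_sequence hε hr₀ hβpos hβ2 hρ hpol⟩
  · intro h0
    have hw0 : w₀ = 0 := by rw [hw₀, h0]; ring
    have hG := besselEntire_zero_pos l
    have hE : besselEuler l w₀ = ((l : ℝ) + 1 / 2) * besselEntire ℝ l 0 := by
      rw [hw0, besselEuler]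
      ring
    have hl : (0 : ℝ) < (l : ℝ) + 1 / 2 := by positivity
    rw [if_neg (by rw [hE]; positivity), hE, hw0]
    congr 1
    field_simp
  · intro h hd
    have hb : besselEuler l w₀ ≠ 0 :=
      fun hb => hd ((deriv_besselIHalf_eq_zero_iff l (hslit h) efimovXi_sq).2 hb)
    refine ⟨_, efimovF_eq_ofReal l (hslit h) efimovXi_sq, ?_⟩
    rw [if_neg hb, ← hw₀]
    congr 1
    generalize besselEuler l w₀ = b at *
    field_simp
  · intro h hd
    exact if_pos ((deriv_besselIHalf_eq_zero_iff l (hslit h) efimovXi_sq).1 hd)
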